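/- Let $k\ge 2$, $m\ge 1$ and $Q\ge 1$ be integers and let $b$ be an integer with $\gcd(b,m)=1$. An integer $n\ge 1$ is called $k$-free if $p^k\nmid n$ for every prime $p\mid n$. Put \[\mathscr{F}_{Q,k}^{(m)}=\left\{\frac{a}{q} : 1\le a\le q\le Q,\ \gcd(a,q)=1,\ q \text{ is } k\text{-free},\ q\equiv b \pmod m\right\}\subset(0,1],\] and $\mathcal{N}=\mathcal{N}(Q,k,m)=\#\mathscr{F}_{Q,k}^{(m)}$. If $\mathcal{N}\ge 1$, the discrepancy of $\mathscr{F}_{Q,k}^{(m)}$ is \[D_{\mathcal{N}}\left(\mathscr{F}_{Q,k}^{(m)}\right)=\sup_{0\le\alpha\le 1}\left|\frac{\#\{\gamma\in\mathscr{F}_{Q,k}^{(m)} : \gamma\le\alpha\}}{\mathcal{N}}-\alpha\right|.\] Then for every $m\ge 1$ there are constants $C_1,C_2>0$, depending only on $m$, such that for all $k\ge 2$, all integers $b$ coprime to $m$, and all $Q\ge 1$ for which $\mathscr{F}_{Q,k}^{(m)}$ is nonempty, \[\frac{C_1}{Q}\le D_{\mathcal{N}}\left(\mathscr{F}_{Q,k}^{(m)}\right)\le\frac{C_2}{Q}.\]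 -/

import Mathlib

noncomputable section

namespace KFreeFarey

/-- `n` is `k`-free: no prime dividing `n` divides it to the `k`-th power. -/
def KFree (k n : ℕ) : Prop :=
  ∀ p : ℕ, p.Prime → p ∣ n → ¬ p ^ k ∣ n

open Classical in
/-- The Farey fractions `a / q` with `1 ≤ a ≤ q ≤ Q`, `gcd(a, q) = 1`, whose denominator `q`
is `k`-free and congruent to `b` modulo `m`, as a finite set of real numbers in `(0, 1]`. -/
def farey (Q k m : ℕ) (b : ℤ) : Finset ℝ :=
  ((Finset.Icc 1 Q ×ˢ Finset.Icc 1 Q).filter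
    (fun x : ℕ × ℕ => x.1 ≤ x.2 ∧ Nat.gcd x.1 x.2 = 1 ∧ KFree k x.2 ∧
      (x.2 : ℤ) ≡ b [ZMOD (m : ℤ)])).image
    (fun x : ℕ × ℕ => (x.1 : ℝ) / (x.2 : ℝ))

theorem mem_farey {Q k m : ℕ} {b : ℤ} {x : ℝ} :
    x ∈ farey Q k m b ↔ ∃ a q : ℕ, 1 ≤ a ∧ a ≤ q ∧ q ≤ Q ∧ Nat.gcd a q = 1 ∧ KFree k q ∧
      (q : ℤ) ≡ b [ZMOD (m : ℤ)] ∧ x = (a : ℝ) / (q : ℝ) := by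
  simp only [farey, Finset.mem_image, Finset.mem_filter, Finset.mem_product, Finset.mem_Icc,
    Prod.exists]
  constructor
  · rintro ⟨a, q, ⟨⟨⟨h1, _⟩, _, h4⟩, h5, h6, h7, h8⟩, rfl⟩
    exact ⟨a, q, h1, h5, h4, h6, h7, h8, rfl⟩
  · rintro ⟨a, q, h1, h2, h3, h4, h5, h6, rfl⟩
    exact ⟨a, q, ⟨⟨⟨h1, h2.trans h3⟩, h1.trans h2, h3⟩, h2, h4, h5, h6⟩, rfl⟩

/-- `A(α)`: the number of points of `S` that do not exceed `α`. -/
def countLE (S : Finset ℝ) (α : ℝ) : ℕ :=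
  (S.filter (fun x => x ≤ α)).card

/-- `R(α) = |A(α) / N - α|`, where `N` is the number of points of `S`. -/
def deviation (S : Finset ℝ) (α : ℝ) : ℝ :=
  |(countLE S α : ℝ) / (S.card : ℝ) - α|

/-- The (absolute) discrepancy `sup_{0 ≤ α ≤ 1} R(α)` of a nonempty finite set `S` of points
of `(0, 1]` (the representatives modulo one being taken in `(0, 1]`). -/
def discrepancy (S : Finset ℝ) : ℝ :=
  ⨆ α : Set.Icc (0 : ℝ) 1, deviation S (α : ℝ)

/-- The supremum defining the discrepancy is over a family bounded above. -/
theorem bddAbove_deviation (S : Finset ℝ) :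
    BddAbove (Set.range fun α : Set.Icc (0 : ℝ) 1 => deviation S (α : ℝ)) := by
  refine ⟨1, ?_⟩
  rintro _ ⟨⟨α, h0, h1⟩, rfl⟩
  have h2 : (countLE S α : ℝ) / (S.card : ℝ) ≤ 1 :=
    div_le_one_of_le₀ (by exact_mod_cast Finset.card_filter_le _ _) (by positivity)
  have h3 : (0 : ℝ) ≤ (countLE S α : ℝ) / (S.card : ℝ) := by positivity
  simp only [deviation]
  rw [abs_le]
  constructor <;> linarith

end KFreeFarey

end

namespace KFreeFarey

noncomputable section

/-! The lower bound is immediate: every fraction is at least `1 / Q`, so at `α = 1 / (2Q)` nothing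
has been counted and the deviation equals `α`.

The upper bound follows from two estimates: `|A(α) - αN| ≤ C Q` uniformly in `α`, `k` and `b`
(`exists_bound_countLE_farey`), and `N ≥ c Q²` for large `Q` (`exists_lower_bound_card_farey`). For
bounded `Q` the trivial bound 1 on the deviation suffices.

For the first, the condition that `q` be `k`-free is expanded as `∑_{l^k ∣ q} μ(l)`. Writing `q =
l^k r`, coprimality to `q` is expanded over `d ∣ l` and over `e ∣ r` with `e` coprime to `l`. The
main terms cancel and fractional parts remain (`coprimeCount_sub_eq`). For fixed `l` and `d`, put `β
= α l^k / d`; what is needed is `∑_{e ≤ Y} f(e) ∑_{n ≤ Y/e} {β n} = O(Y)`, uniformly in `β`, where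
`n` runs over a residue class and `f` is `μ` restricted to a class mod `m` and to integers coprime
to `l`. Since `Y ≤ Q / l²`, the sum over `l` and `d` then converges through `∑ τ(l)² / l² ≤ 16`.

The only arithmetic input on `f` is that `∑ f(e) / e` has bounded partial sums; this comes from
`L(1, χ) ≠ 0` (`exists_bound_moebius_progression`). The bound for the double sum is
`abs_sum_mul_sawSum_le`. Let `q_i` be the denominators of the best approximations of the slope. When
the inner sum has between `q_i` and `q_{i+1}` terms, it is cut into blocks of length `q_i`, each
with bounded sawtooth sum. A block sum is the difference of two monotone functions of its index, so
partial summation against `f(e) / e` gives `O(Y / q_i)`. Because `q_{i+2} ≥ 2 q_i`, the total over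
`i` is bounded by an absolute constant, whatever the slope.

For the second, denominators are restricted to a class free of primes up to 16, where union bounds
for non-coprime numerators and for square divisors lose less than the main term. -/

/-! ### Best approximations of an irrational number -/

/-- The distance from `n * θ` to the nearest integer. -/
def distInt (θ : ℝ) (n : ℕ) : ℝ := |n * θ - round (n * θ)|

theorem distInt_le (θ : ℝ) (n : ℕ) (z : ℤ) : distInt θ n ≤ |n * θ - z| := round_le _ _

theorem mul_sub_int_ne_zero {θ : ℝ} (hθ : Irrational θ) {n : ℕ} (hn : 1 ≤ n) (z : ℤ) :
    (n : ℝ) * θ - z ≠ 0 := by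
  have h := (hθ.natCast_mul (by omega : n ≠ 0)).sub_intCast z
  exact h.ne_zero

theorem distInt_pos {θ : ℝ} (hθ : Irrational θ) {n : ℕ} (hn : 1 ≤ n) : 0 < distInt θ n :=
  abs_pos.2 (mul_sub_int_ne_zero hθ hn _)

theorem exists_distInt_lt {θ : ℝ} (hθ : Irrational θ) (n : ℕ) :
    ∃ k, 1 ≤ k ∧ (1 ≤ n → distInt θ k < distInt θ n) := by
  by_cases hn : 1 ≤ n
  · obtain ⟨N, hN⟩ := exists_nat_one_div_lt (distInt_pos hθ hn)
    obtain ⟨k, hk0, _, hk⟩ := Real.exists_nat_abs_mul_sub_round_le θ (Nat.succ_pos N)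
    refine ⟨k, hk0, fun _ => lt_of_le_of_lt hk (lt_of_le_of_lt ?_ hN)⟩
    push_cast
    exact one_div_le_one_div_of_le (by positivity) (by linarith)
  -- A default for `n = 0`, so that `Nat.find` applies to every `n`; records start at 1 and never
  -- use it.
  · exact ⟨1, le_rfl, fun h => absurd h hn⟩

open Classical in
/-- The denominators of successive best approximations of `θ`. -/
def recordDen {θ : ℝ} (hθ : Irrational θ) : ℕ → ℕ
  | 0 => 1
  | i + 1 => Nat.find (exists_distInt_lt hθ (recordDen hθ i))

theorem one_le_recordDen {θ : ℝ} (hθ : Irrational θ) (i : ℕ) : 1 ≤ recordDen hθ i := by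
  classical
  cases i with
  | zero => exact le_rfl
  | succ i => rw [recordDen]; exact (Nat.find_spec (exists_distInt_lt hθ (recordDen hθ i))).1

theorem distInt_recordDen_succ {θ : ℝ} (hθ : Irrational θ) (i : ℕ) :
    distInt θ (recordDen hθ (i + 1)) < distInt θ (recordDen hθ i) := by
  classical
  rw [recordDen]
  exact (Nat.find_spec (exists_distInt_lt hθ (recordDen hθ i))).2 (one_le_recordDen hθ i)

theorem distInt_le_of_lt_recordDen {θ : ℝ} (hθ : Irrational θ) (i : ℕ) {k : ℕ} (hk : 1 ≤ k)
    (hlt : k < recordDen hθ (i + 1)) : distInt θ (recordDen hθ i) ≤ distInt θ k := by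
  classical
  rw [recordDen] at hlt
  have := Nat.find_min _ hlt
  push Not at this
  exact (this hk).2

theorem distInt_recordDen_lt {θ : ℝ} (hθ : Irrational θ) (i : ℕ) {k : ℕ} (hk : 1 ≤ k)
    (hlt : k < recordDen hθ i) : distInt θ (recordDen hθ i) < distInt θ k := by
  cases i with
  | zero => simp only [recordDen] at hlt; omega
  | succ i =>
    exact lt_of_lt_of_le (distInt_recordDen_succ hθ i) (distInt_le_of_lt_recordDen hθ i hk hlt)

theorem recordDen_strictMono {θ : ℝ} (hθ : Irrational θ) : StrictMono (recordDen hθ) := by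
  refine strictMono_nat_of_lt_succ fun i => ?_
  by_contra! h
  have h1 := distInt_recordDen_succ hθ i
  rcases h.lt_or_eq with h | h
  · exact lt_asymm h1 (distInt_recordDen_lt hθ i (one_le_recordDen hθ _) h)
  · rw [h] at h1; exact lt_irrefl _ h1

/-- Dirichlet's theorem with bound `recordDen hθ (i + 1) - 1` produces a multiplier below the next
record, and no such multiplier does better than record `i`. -/
theorem distInt_recordDen_le {θ : ℝ} (hθ : Irrational θ) (i : ℕ) :
    distInt θ (recordDen hθ i) ≤ 1 / recordDen hθ (i + 1) := by
  have h1 : recordDen hθ i < recordDen hθ (i + 1) := recordDen_strictMono hθ (Nat.lt_succ_self i)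
  have h2 := one_le_recordDen hθ i
  obtain ⟨k, hk0, hk1, hk⟩ := Real.exists_nat_abs_mul_sub_round_le θ
    (show 0 < recordDen hθ (i + 1) - 1 by omega)
  refine (distInt_le_of_lt_recordDen hθ i hk0 (by omega)).trans (hk.trans (le_of_eq ?_))
  rw [Nat.cast_sub (by omega)]
  simp

/-- Dividing out a common factor `g ≥ 2` would give a smaller multiplier whose distance is at most
`1 / g` of the record. -/
theorem recordDen_isCoprime {θ : ℝ} (hθ : Irrational θ) (i : ℕ) :
    IsCoprime (round (recordDen hθ i * θ)) (recordDen hθ i : ℤ) := by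
  set q := recordDen hθ i with hq
  have hq1 : 1 ≤ q := one_le_recordDen hθ i
  set p := round (q * θ) with hp
  rw [Int.isCoprime_iff_gcd_eq_one]
  by_contra hg
  obtain ⟨p', hp'⟩ := Int.gcd_dvd_left p q
  obtain ⟨q', hq'⟩ := Int.natCast_dvd_natCast.1 (Int.gcd_dvd_right p q)
  set g := Int.gcd p q with hgdef
  have hg0 : g ≠ 0 := by rintro h0; rw [h0] at hq'; omega
  have hg2 : 2 ≤ g := by omega
  have hq'0 : 1 ≤ q' := by
    rcases Nat.eq_zero_or_pos q' with h | h
    · rw [h] at hq'; omega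
    · exact h
  have hlt : q' < q := by rw [hq']; nlinarith
  have h1 := distInt_recordDen_lt hθ i hq'0 hlt
  have h2 := distInt_le θ q' p'
  have h3 : distInt θ q = g * |q' * θ - p'| := by
    have : (q : ℝ) * θ - p = g * (q' * θ - p') := by
      rw [hp']; rw [show (q : ℝ) = g * q' by exact_mod_cast hq']; push_cast; ring
    rw [distInt, ← hp, this, abs_mul, abs_of_nonneg (by positivity)]
  rw [← hq, h3] at h1
  have h4 : (2 : ℝ) ≤ g := by exact_mod_cast hg2
  nlinarith [abs_nonneg ((q' : ℝ) * θ - p')]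

/-- With equal signs, the difference of the two denominators has error smaller in size than that of
record `a`; hence this difference is at least the next record. -/
theorem recordDen_add_le_of_sameSign {θ : ℝ} (hθ : Irrational θ) {a b : ℕ} (hab : a < b)
    (hs : 0 < (recordDen hθ a * θ - round (recordDen hθ a * θ)) *
      (recordDen hθ b * θ - round (recordDen hθ b * θ))) :
    recordDen hθ a + recordDen hθ (a + 1) ≤ recordDen hθ b := by
  by_contra! h
  have hlt := recordDen_strictMono hθ hab
  have hle := distInt_le_of_lt_recordDen hθ a (k := recordDen hθ b - recordDen hθ a) (by omega)
    (by omega)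
  have h1 := distInt_le θ (recordDen hθ b - recordDen hθ a)
    (round (recordDen hθ b * θ) - round (recordDen hθ a * θ))
  have h2 := distInt_recordDen_lt hθ b (one_le_recordDen hθ a) hlt
  rw [Nat.cast_sub hlt.le] at h1
  push_cast at h1
  have h3 := hle.trans h1
  simp only [distInt] at h2 h3
  set x := recordDen hθ a * θ - round (recordDen hθ a * θ)
  set y := recordDen hθ b * θ - round (recordDen hθ b * θ)
  rw [show ((recordDen hθ b : ℝ) - recordDen hθ a) * θ -
    (round (recordDen hθ b * θ) - round (recordDen hθ a * θ)) = y - x by simp only [x, y]; ring] at h3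
  rcases lt_or_ge 0 x with hx | hx
  · have hy : 0 < y := by by_contra! hy; nlinarith
    rw [abs_of_pos hx, abs_of_pos hy] at h2
    rw [abs_of_pos hx, abs_of_neg (by linarith)] at h3
    linarith
  · have hx' : x < 0 := lt_of_le_of_ne hx (by rintro h0; rw [h0] at hs; simp at hs)
    have hy : y < 0 := by by_contra! hy; nlinarith
    rw [abs_of_neg hx', abs_of_neg hy] at h2
    rw [abs_of_neg hx', abs_of_pos (by linarith)] at h3
    linarith

/-- Two of three consecutive errors have the same sign. This replaces the continued fraction
recurrence and gives geometric growth in steps of two. -/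
theorem two_mul_recordDen_le {θ : ℝ} (hθ : Irrational θ) (i : ℕ) :
    2 * recordDen hθ i ≤ recordDen hθ (i + 2) := by
  have key : ∀ a b : ℕ, i ≤ a → a < b → b ≤ i + 2 →
      0 < (recordDen hθ a * θ - round (recordDen hθ a * θ)) *
      (recordDen hθ b * θ - round (recordDen hθ b * θ)) →
      2 * recordDen hθ i ≤ recordDen hθ (i + 2) := by
    intro a b ha hab hb hs
    have h1 := recordDen_add_le_of_sameSign hθ hab hs
    have h2 := (recordDen_strictMono hθ).monotone ha
    have h3 := (recordDen_strictMono hθ).monotone hb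
    have h4 := (recordDen_strictMono hθ).monotone (ha.trans (Nat.le_succ a))
    simp only [Nat.succ_eq_add_one] at h4
    omega
  have h0 := mul_sub_int_ne_zero hθ (one_le_recordDen hθ i) (round (recordDen hθ i * θ))
  have h1 := mul_sub_int_ne_zero hθ (one_le_recordDen hθ (i + 1)) (round (recordDen hθ (i + 1) * θ))
  have h2 := mul_sub_int_ne_zero hθ (one_le_recordDen hθ (i + 2)) (round (recordDen hθ (i + 2) * θ))
  have k01 := key i (i + 1) (by omega) (by omega) (by omega)
  have k02 := key i (i + 2) (by omega) (by omega) (by omega)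
  have k12 := key (i + 1) (i + 2) (by omega) (by omega) (by omega)
  rcases h0.lt_or_gt with h0 | h0 <;> rcases h1.lt_or_gt with h1 | h1 <;>
    rcases h2.lt_or_gt with h2 | h2 <;>
    first
      | exact k01 (mul_pos h0 h1)
      | exact k02 (mul_pos h0 h2)
      | exact k12 (mul_pos h1 h2)
      | exact k01 (mul_pos_of_neg_of_neg h0 h1)
      | exact k02 (mul_pos_of_neg_of_neg h0 h2)
      | exact k12 (mul_pos_of_neg_of_neg h1 h2)

/-! ### Sawtooth sums along arithmetic progressions -/

/-- Sum of the sawtooth function along the progression `θ t + φ`, `t < n`. -/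
def sawSum (θ φ : ℝ) (n : ℕ) : ℝ := ∑ t ∈ Finset.range n, (Int.fract (θ * t + φ) - 1 / 2)

theorem sawSum_add (θ φ : ℝ) (a b : ℕ) :
    sawSum θ φ (a + b) = sawSum θ φ a + sawSum θ (θ * a + φ) b := by
  simp only [sawSum, Finset.sum_range_add]
  congr 1
  refine Finset.sum_congr rfl fun t _ => ?_
  push_cast
  ring_nf

theorem sum_range_emod_of_isCoprime {M : Type*} [AddCommMonoid M] {p : ℤ} {q : ℕ} (hq : 1 ≤ q)
    (h : IsCoprime p (q : ℤ)) (v : ℤ) (g : ℕ → M) :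
    ∑ r ∈ Finset.range q, g ((p * r + v) % q).toNat = ∑ w ∈ Finset.range q, g w := by
  have hq' : (0 : ℤ) < q := by exact_mod_cast hq
  have hinj : Set.InjOn (fun r : ℕ => ((p * r + v) % q).toNat) (Finset.range q) := by
    intro r hr s hs hrs
    simp only [Finset.coe_range, Set.mem_Iio] at hr hs
    have h1 := Int.emod_nonneg (p * r + v) hq'.ne'
    have h2 := Int.emod_nonneg (p * s + v) hq'.ne'
    have h3 : (p * r + v) % q = (p * s + v) % q := by
      simp only at hrs
      omega
    have h4 : (q : ℤ) ∣ p * (s - r) := by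
      have := Int.ModEq.dvd h3
      convert this using 1; ring
    have h5 : (q : ℤ) ∣ s - r := h.symm.dvd_of_dvd_mul_left h4
    have h6 : |(s : ℤ) - r| < q := by rw [abs_lt]; constructor <;> omega
    have := Int.eq_zero_of_abs_lt_dvd h5 h6
    omega
  have himg : (Finset.range q).image (fun r : ℕ => ((p * r + v) % q).toNat) = Finset.range q := by
    apply Finset.eq_of_subset_of_card_le
    · intro w hw
      obtain ⟨r, _, rfl⟩ := Finset.mem_image.1 hw
      have h1 := Int.emod_nonneg (p * r + v) hq'.ne'
      have h2 := Int.emod_lt_of_pos (p * r + v) hq'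
      rw [Finset.mem_range]; omega
    · rw [Finset.card_image_of_injOn hinj]
  conv_rhs => rw [← himg]
  rw [Finset.sum_image hinj]

/-- Replacing `θ` by `p / q` and `φ` by `v / q` turns the points into a permutation of `w / q`, with
each numerator shifted by an amount in `(-1, 2)`. Only residues 0 and `q - 1` can wrap around,
costing 1 each; the others cost `2 / q`. The mean of `w / q` contributes the extra `1 / 2`. -/
theorem abs_sawSum_den_le {θ : ℝ} {p : ℤ} {q : ℕ} (hq : 1 ≤ q) (h : IsCoprime p (q : ℤ))
    (hθ : |q * θ - p| ≤ 1 / q) (φ : ℝ) : |sawSum θ φ q| ≤ 5 := by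
  have hq0 : (0 : ℝ) < q := by exact_mod_cast hq
  have hqZ : (0 : ℤ) < q := by exact_mod_cast hq
  set v := ⌊(q : ℝ) * φ⌋ with hv
  let W : ℕ → ℕ := fun r => ((p * r + v) % q).toNat
  have hloc : ∀ r ∈ Finset.range q, |Int.fract (θ * r + φ) - (W r : ℝ) / q| ≤
      2 / q + ((if W r = 0 then 1 else 0) + (if W r = q - 1 then 1 else 0)) := by
    intro r hr
    rw [Finset.mem_range] at hr
    have hw0 := Int.emod_nonneg (p * r + v) hqZ.ne'
    have hw1 := Int.emod_lt_of_pos (p * r + v) hqZ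
    have hWc : ((W r : ℕ) : ℤ) = (p * r + v) % q := Int.toNat_of_nonneg hw0
    have hWlt : W r < q := by omega
    have hWq : (W r : ℝ) / q < 1 := by rw [div_lt_one hq0]; exact_mod_cast hWlt
    have hWq0 : 0 ≤ (W r : ℝ) / q := by positivity
    have hf0 := Int.fract_nonneg (θ * r + φ)
    have hf1 := Int.fract_lt_one (θ * r + φ)
    by_cases hw : W r = 0 ∨ W r = q - 1
    · have h1 : (1 : ℝ) ≤ (if W r = 0 then 1 else 0) + (if W r = q - 1 then 1 else 0) := by
        rcases hw with hw | hw <;> simp only [hw, if_true] <;> split_ifs <;> norm_num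
      have h2 : (0 : ℝ) < 2 / q := by positivity
      have : |Int.fract (θ * r + φ) - (W r : ℝ) / q| ≤ 1 := by
        rw [abs_le]; constructor <;> linarith
      linarith
    · push Not at hw
      set η := r * (q * θ - p) + Int.fract ((q : ℝ) * φ) with hη
      have hr1 : |r * (q * θ - p)| < 1 := by
        rw [abs_mul, abs_of_nonneg (by positivity)]
        calc (r : ℝ) * |q * θ - p| ≤ r * (1 / q) := by gcongr
          _ < 1 := by rw [mul_one_div, div_lt_one hq0]; exact_mod_cast hr
      rw [abs_lt] at hr1
      have hφ0 := Int.fract_nonneg ((q : ℝ) * φ)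
      have hφ1 := Int.fract_lt_one ((q : ℝ) * φ)
      have hdecomp : (p : ℝ) * r + v = q * ((p * r + v) / q : ℤ) + W r := by
        have := Int.mul_ediv_add_emod (p * r + v) q
        rw [← hWc] at this
        exact_mod_cast this.symm
      have hx : θ * r + φ = ((p * r + v) / q : ℤ) + (W r + η) / q := by
        have h3 : (q : ℝ) * φ = v + Int.fract ((q : ℝ) * φ) := (Int.floor_add_fract _).symm
        field_simp
        rw [hη]
        linear_combination h3 + hdecomp
      have hW1 : (1 : ℝ) ≤ W r := by exact_mod_cast (by omega : 1 ≤ W r)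
      have hW2 : (W r : ℝ) + 2 ≤ q := by exact_mod_cast (by omega : W r + 2 ≤ q)
      have hfr : Int.fract (θ * r + φ) = (W r + η) / q := by
        rw [hx, Int.fract_intCast_add, Int.fract_eq_self]
        constructor
        · apply div_nonneg _ hq0.le; linarith
        · rw [div_lt_one hq0]; linarith
      rw [hfr, if_neg hw.1, if_neg hw.2, ← sub_div, add_sub_cancel_left, abs_div, abs_of_pos hq0,
        add_zero, add_zero]
      gcongr
      rw [abs_le]; constructor <;> linarith
  have hsum1 : ∑ r ∈ Finset.range q, (W r : ℝ) / q = (q - 1) / 2 := by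
    rw [sum_range_emod_of_isCoprime hq h v (fun w => (w : ℝ) / q), ← Finset.sum_div,
      ← Nat.cast_sum, Finset.sum_range_id, Nat.cast_div (Nat.even_mul_pred_self q).two_dvd (by norm_num),
      Nat.cast_mul, Nat.cast_sub hq]
    field_simp
    push_cast
    ring
  -- For `q = 1` the two exceptional residues coincide, and the sum of the two indicators is still
  -- 2.
  have hsum2 : ∑ r ∈ Finset.range q, ((if W r = 0 then (1 : ℝ) else 0) +
      (if W r = q - 1 then 1 else 0)) = 2 := by
    rw [sum_range_emod_of_isCoprime hq h v
      (fun w => (if w = 0 then (1 : ℝ) else 0) + (if w = q - 1 then 1 else 0)),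
      Finset.sum_add_distrib, Finset.sum_ite_eq', Finset.sum_ite_eq', if_pos, if_pos]
    · norm_num
    · rw [Finset.mem_range]; omega
    · rw [Finset.mem_range]; omega
  have hmain : |∑ r ∈ Finset.range q, (Int.fract (θ * r + φ) - (W r : ℝ) / q)| ≤ 4 := by
    refine (Finset.abs_sum_le_sum_abs _ _).trans ((Finset.sum_le_sum hloc).trans ?_)
    rw [Finset.sum_add_distrib, hsum2, Finset.sum_const, Finset.card_range, nsmul_eq_mul,
      mul_div_cancel₀ _ hq0.ne']
    norm_num
  have : sawSum θ φ q = ∑ r ∈ Finset.range q, (Int.fract (θ * r + φ) - (W r : ℝ) / q) - 1 / 2 := by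
    rw [sawSum, Finset.sum_sub_distrib, Finset.sum_sub_distrib, hsum1]
    simp
    ring
  rw [this]
  rw [abs_le] at hmain ⊢
  constructor <;> linarith

theorem sawSum_mul_add (θ φ : ℝ) (q K s : ℕ) :
    sawSum θ φ (q * K + s) = ∑ k ∈ Finset.range K, sawSum θ (θ * (q * k : ℕ) + φ) q +
      sawSum θ (θ * (q * K : ℕ) + φ) s := by
  rw [sawSum_add]
  congr 1
  induction K with
  | zero => simp [sawSum]
  | succ K ih => rw [Nat.mul_succ, sawSum_add, ih, Finset.sum_range_succ]

/-- Bounds for the sawtooth sums over fewer than `q i` terms. -/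
def remainderBound (q : ℕ → ℕ) : ℕ → ℝ
  | 0 => 0
  | i + 1 => remainderBound q i + 5 * (q (i + 1) / q i)

theorem remainderBound_nonneg (q : ℕ → ℕ) (i : ℕ) : 0 ≤ remainderBound q i := by
  induction i with
  | zero => exact le_rfl
  | succ i ih => rw [remainderBound]; positivity

theorem abs_sawSum_recordDen_le {θ : ℝ} (hθ : Irrational θ) (i : ℕ) (φ : ℝ) :
    |sawSum θ φ (recordDen hθ i)| ≤ 5 := by
  have h0 := one_le_recordDen hθ i
  refine abs_sawSum_den_le h0 (recordDen_isCoprime hθ i)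
    ((distInt_recordDen_le hθ i).trans ?_) φ
  have h1 : (recordDen hθ i : ℝ) ≤ recordDen hθ (i + 1) := by
    exact_mod_cast (recordDen_strictMono hθ).monotone (Nat.le_succ i)
  have h2 : (0 : ℝ) < recordDen hθ i := by exact_mod_cast h0
  exact one_div_le_one_div_of_le h2 h1

/-- Greedy expansion of `n` in the denominators: at each level at most `q (i + 1) / q i` full
blocks, each of size at most 5, and a remainder passed down. -/
theorem abs_sawSum_le_remainderBound {θ : ℝ} (hθ : Irrational θ) (i : ℕ) :
    ∀ (φ : ℝ) (n : ℕ), n < recordDen hθ i → |sawSum θ φ n| ≤ remainderBound (recordDen hθ) i := by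
  induction i with
  | zero =>
    intro φ n hn
    have : n = 0 := by simp only [recordDen] at hn; omega
    simp [this, sawSum, remainderBound]
  | succ i ih =>
    intro φ n hn
    have h0 := one_le_recordDen hθ i
    have hq : (0 : ℝ) < recordDen hθ i := by exact_mod_cast h0
    rw [← Nat.div_add_mod n (recordDen hθ i), sawSum_mul_add, remainderBound, add_comm]
    refine (abs_add_le _ _).trans (add_le_add (ih _ _ (Nat.mod_lt _ (by omega))) ?_)
    refine (Finset.abs_sum_le_sum_abs _ _).trans
      ((Finset.sum_le_sum fun k _ => abs_sawSum_recordDen_le hθ i _).trans ?_)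
    rw [Finset.sum_const, Finset.card_range, nsmul_eq_mul, mul_comm]
    gcongr
    refine Nat.cast_div_le.trans ?_
    gcongr

/-- The sum `S` satisfies `S ≤ 2 + S / 2`: two initial terms, then doubling. -/
theorem sum_inv_le_of_doubling {q : ℕ → ℕ} (h1 : ∀ i, 1 ≤ q i)
    (h2 : ∀ i, 2 * q i ≤ q (i + 2)) (n : ℕ) : ∑ i ∈ Finset.range n, (1 : ℝ) / q i ≤ 4 := by
  have hle : ∀ i, (1 : ℝ) / q i ≤ 1 := fun i => by
    rw [div_le_one (by exact_mod_cast h1 i)]; exact_mod_cast h1 i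
  have hstep : ∀ i, (1 : ℝ) / q (i + 2) ≤ 1 / 2 * (1 / q i) := fun i => by
    have : (0 : ℝ) < q i := by exact_mod_cast h1 i
    rw [div_mul_div_comm, one_mul]
    exact one_div_le_one_div_of_le (by positivity) (by exact_mod_cast h2 i)
  have hmono : ∑ i ∈ Finset.range n, (1 : ℝ) / q i ≤ ∑ i ∈ Finset.range (n + 2), (1 : ℝ) / q i :=
    Finset.sum_le_sum_of_subset_of_nonneg (Finset.range_mono (by omega))
      fun _ _ _ => by positivity
  have hs : ∑ i ∈ Finset.range n, (1 : ℝ) / q (i + 2) ≤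
      1 / 2 * ∑ i ∈ Finset.range n, (1 : ℝ) / q i := by
    rw [Finset.mul_sum]; exact Finset.sum_le_sum fun i _ => hstep i
  rw [Finset.sum_range_succ', Finset.sum_range_succ'] at hmono
  have := hle 0
  have := hle (0 + 1)
  linarith

/-- The terms satisfy `z (i + 2) ≤ z i / 2 + 10 / q i` with `z 0 = 0` and `z 1 = 5`, so the sum
obeys `S ≤ 5 + S / 2 + 10 * 4`. -/
theorem sum_remainderBound_div_le {q : ℕ → ℕ} (h0 : q 0 = 1) (h1 : ∀ i, 1 ≤ q i)
    (hmono : Monotone q) (h2 : ∀ i, 2 * q i ≤ q (i + 2)) (n : ℕ) :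
    ∑ i ∈ Finset.range n, remainderBound q i / q i ≤ 90 := by
  have hpos : ∀ i, (0 : ℝ) < q i := fun i => by exact_mod_cast h1 i
  have hx0 : remainderBound q 0 / q 0 = 0 := by simp [remainderBound]
  have hx1 : remainderBound q (0 + 1) / q (0 + 1) = 5 := by
    simp only [remainderBound, h0]
    have := hpos (0 + 1)
    field_simp
    simp
  have hstep : ∀ i, remainderBound q (i + 2) / q (i + 2) ≤
      1 / 2 * (remainderBound q i / q i) + 10 * (1 / q i) := fun i => by
    have ha := hpos i
    have hb := hpos (i + 1)
    have hc := hpos (i + 2)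
    have hab : (q i : ℝ) ≤ q (i + 1) := by exact_mod_cast hmono (Nat.le_succ i)
    have hbc : (q (i + 1) : ℝ) ≤ q (i + 2) := by exact_mod_cast hmono (Nat.le_succ (i + 1))
    have hac : 2 * (q i : ℝ) ≤ q (i + 2) := by exact_mod_cast h2 i
    have hz := remainderBound_nonneg q i
    have e : remainderBound q (i + 2) / q (i + 2) = remainderBound q i / q (i + 2) +
        5 * (q (i + 1) / q (i + 2)) * (1 / q i) + 5 * (1 / q (i + 1)) := by
      simp only [remainderBound]
      field_simp
    have e1 : remainderBound q i / q (i + 2) ≤ 1 / 2 * (remainderBound q i / q i) := by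
      rw [div_mul_div_comm, one_mul]
      exact div_le_div_of_nonneg_left hz (by positivity) hac
    have e2 : (q (i + 1) : ℝ) / q (i + 2) ≤ 1 := (div_le_one hc).2 hbc
    have e3 : (1 : ℝ) / q (i + 1) ≤ 1 / q i := one_div_le_one_div_of_le ha hab
    have e4 : (q (i + 1) : ℝ) / q (i + 2) * (1 / q i) ≤ 1 * (1 / q i) := by gcongr
    rw [e]
    linarith
  have hm : ∑ i ∈ Finset.range n, remainderBound q i / q i ≤
      ∑ i ∈ Finset.range (n + 2), remainderBound q i / q i :=
    Finset.sum_le_sum_of_subset_of_nonneg (Finset.range_mono (by omega))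
      fun _ _ _ => div_nonneg (remainderBound_nonneg q _) (by positivity)
  have hs : ∑ i ∈ Finset.range n, remainderBound q (i + 2) / q (i + 2) ≤
      1 / 2 * ∑ i ∈ Finset.range n, remainderBound q i / q i +
        10 * ∑ i ∈ Finset.range n, (1 : ℝ) / q i := by
    rw [Finset.mul_sum, Finset.mul_sum, ← Finset.sum_add_distrib]
    exact Finset.sum_le_sum fun i _ => hstep i
  rw [Finset.sum_range_succ', Finset.sum_range_succ', hx0, hx1] at hm
  have := sum_inv_le_of_doubling h1 h2 n
  linarith

/-! ### Partial summation against weights with bounded logarithmic sums -/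

theorem abs_sum_Ioc_mul_le_of_monotone {a u : ℕ → ℝ} {B : ℝ}
    (hB : ∀ n, |∑ d ∈ Finset.Ioc 0 n, a d| ≤ B) {x y : ℕ} (hxy : x < y)
    (hu : ∀ d, x < d → d < y → u d ≤ u (d + 1)) :
    |∑ d ∈ Finset.Ioc x y, a d * u d| ≤ B * (|u y| + |u (x + 1)| + (u y - u (x + 1))) := by
  set A : ℕ → ℝ := fun n => ∑ d ∈ Finset.Ioc 0 n, a d with hA
  have hsucc : ∀ n, A (n + 1) = A n + a (n + 1) := fun n => by
    simp only [hA]; rw [Finset.sum_Ioc_succ_top (Nat.zero_le n)]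
  have key : ∀ z, x + 1 ≤ z → z ≤ y →
      |∑ d ∈ Finset.Ioc x z, a d * u d - A z * u z + A x * u (x + 1)| ≤
        B * (u z - u (x + 1)) := by
    intro z hz
    induction z, hz using Nat.le_induction with
    | base =>
      intro _
      rw [Finset.sum_Ioc_succ_top le_rfl, Finset.Ioc_self, Finset.sum_empty, hsucc]
      rw [show 0 + a (x + 1) * u (x + 1) - (A x + a (x + 1)) * u (x + 1) + A x * u (x + 1) = 0 by
        ring]
      simp
    | succ z hz ih =>
      intro hzy
      have h1 := ih (by omega)
      rw [Finset.sum_Ioc_succ_top (by omega), hsucc]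
      have h2 := hu z (by omega) (by omega)
      have h3 : |A z * (u (z + 1) - u z)| ≤ B * (u (z + 1) - u z) := by
        rw [abs_mul, abs_of_nonneg (sub_nonneg.2 h2)]
        exact mul_le_mul_of_nonneg_right (hB z) (by linarith)
      rw [show ∑ d ∈ Finset.Ioc x z, a d * u d + a (z + 1) * u (z + 1) -
        (A z + a (z + 1)) * u (z + 1) + A x * u (x + 1) =
        (∑ d ∈ Finset.Ioc x z, a d * u d - A z * u z + A x * u (x + 1)) -
          A z * (u (z + 1) - u z) by ring]
      refine (abs_sub _ _).trans ?_
      linarith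
  have h1 := key y hxy le_rfl
  have h2 : |A y * u y| ≤ B * |u y| := by
    rw [abs_mul]; exact mul_le_mul_of_nonneg_right (hB y) (abs_nonneg _)
  have h3 : |A x * u (x + 1)| ≤ B * |u (x + 1)| := by
    rw [abs_mul]; exact mul_le_mul_of_nonneg_right (hB x) (abs_nonneg _)
  rw [show ∑ d ∈ Finset.Ioc x y, a d * u d = (∑ d ∈ Finset.Ioc x y, a d * u d - A y * u y +
    A x * u (x + 1)) + A y * u y - A x * u (x + 1) by ring]
  refine (abs_sub _ _).trans ?_
  have := abs_add_le (∑ d ∈ Finset.Ioc x y, a d * u d - A y * u y + A x * u (x + 1)) (A y * u y)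
  linarith

/-- The mean of the first `K` terms of a sequence. -/
def runningMean (b : ℕ → ℝ) (K : ℕ) : ℝ := (∑ k ∈ Finset.range K, b k) / K

theorem runningMean_mono {b : ℕ → ℝ} (hb : Monotone b) {K L : ℕ} (hK : 1 ≤ K) (hKL : K ≤ L) :
    runningMean b K ≤ runningMean b L := by
  induction L, hKL using Nat.le_induction with
  | base => exact le_rfl
  | succ L hL ih =>
    refine ih.trans ?_
    have hL0 : (0 : ℝ) < L := by exact_mod_cast (by omega : 0 < L)
    have h : ∑ k ∈ Finset.range L, b k ≤ L * b L := by
      have := Finset.sum_le_card_nsmul (Finset.range L) b (b L)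
        fun k hk => hb (Finset.mem_range.1 hk).le
      simpa using this
    rw [runningMean, runningMean, div_le_div_iff₀ hL0 (by positivity), Finset.sum_range_succ]
    push_cast
    nlinarith

theorem abs_runningMean_le {b : ℕ → ℝ} {V : ℝ} {K : ℕ} (hK : 1 ≤ K) (hb : ∀ k < K, |b k| ≤ V) :
    |runningMean b K| ≤ V := by
  have hK0 : (0 : ℝ) < K := by exact_mod_cast hK
  rw [runningMean, abs_div, abs_of_pos hK0, div_le_iff₀ hK0, mul_comm]
  refine (Finset.abs_sum_le_sum_abs _ _).trans ?_
  simpa using Finset.sum_le_card_nsmul (Finset.range K) (fun k => |b k|) V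
    fun k hk => hb k (Finset.mem_range.1 hk)

/-- An inner sum is `K d` times a running mean. The mean is monotone in `d` because `b` is monotone
or antitone and `K` decreases, so replacing `K d` by `X / d` leaves a sum to which partial summation
with `f d / d` applies. The rounding error 3 is paid termwise and gives `3 * V * y`. -/
theorem abs_sum_Ioc_mul_sum_range_le {f : ℕ → ℝ} {B V X : ℝ} (hf : ∀ d, |f d| ≤ 1)
    (hB : ∀ n, |∑ d ∈ Finset.Ioc 0 n, f d / d| ≤ B) {b : ℕ → ℝ} (hb : Monotone b ∨ Antitone b)
    {x y : ℕ} {K : ℕ → ℕ} (hX : 0 ≤ X) (hV : 0 ≤ V)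
    (hK1 : ∀ d, x < d → d ≤ y → 1 ≤ K d) (hKb : ∀ d, x < d → d ≤ y → ∀ k < K d, |b k| ≤ V)
    (hKX : ∀ d, x < d → d ≤ y → |K d - X / d| ≤ 3)
    (hK : ∀ d, x < d → d < y → K (d + 1) ≤ K d) :
    |∑ d ∈ Finset.Ioc x y, f d * ∑ k ∈ Finset.range (K d), b k| ≤ 4 * B * V * X + 3 * V * y := by
  have hB0 : 0 ≤ B := (abs_nonneg _).trans (hB 0)
  wlog hmono : Antitone b generalizing b
  · have := this (b := fun k => -b k) (hb.symm.imp (fun h => h.neg) (fun h => h.neg))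
      (fun d h1 h2 k hk => by rw [abs_neg]; exact hKb d h1 h2 k hk)
      ((hb.resolve_right hmono).neg)
    simpa [Finset.sum_neg_distrib] using this
  rcases le_or_gt y x with hyx | hxy
  · rw [Finset.Ioc_eq_empty (by omega)]
    simp only [Finset.sum_empty, abs_zero]
    positivity
  set u : ℕ → ℝ := fun d => runningMean b (K d) with hu
  have huV : ∀ d, x < d → d ≤ y → |u d| ≤ V := fun d h1 h2 =>
    abs_runningMean_le (hK1 d h1 h2) (hKb d h1 h2)
  have hmeanneg : ∀ L, runningMean (fun k => -b k) L = -runningMean b L := fun L => by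
    simp [runningMean, Finset.sum_neg_distrib, neg_div]
  have humono : ∀ d, x < d → d < y → u d ≤ u (d + 1) := fun d h1 h2 => by
    have := runningMean_mono hmono.neg (hK1 (d + 1) (by omega) (by omega)) (hK d h1 h2)
    change runningMean (fun k => -b k) _ ≤ runningMean (fun k => -b k) _ at this
    rw [hmeanneg, hmeanneg] at this
    simp only [hu]; linarith
  have habel := abs_sum_Ioc_mul_le_of_monotone hB hxy humono
  have h1 := huV y hxy le_rfl
  have h2 := huV (x + 1) (by omega) (by omega)
  have hmain : |∑ d ∈ Finset.Ioc x y, f d / d * u d| ≤ 4 * B * V := by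
    refine habel.trans ?_
    rw [abs_le] at h1 h2
    have : |u y| + |u (x + 1)| + (u y - u (x + 1)) ≤ 4 * V := by
      have h3 := abs_le.2 h1
      have h4 := abs_le.2 h2
      linarith
    nlinarith
  have hsplit : ∀ d ∈ Finset.Ioc x y, f d * ∑ k ∈ Finset.range (K d), b k =
      X * (f d / d * u d) + f d * ((K d - X / d) * u d) := fun d hd => by
    rw [Finset.mem_Ioc] at hd
    have hK0 : (K d : ℝ) ≠ 0 := by exact_mod_cast (by have := hK1 d hd.1 hd.2; omega : K d ≠ 0)
    have : ∑ k ∈ Finset.range (K d), b k = K d * u d := by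
      simp only [hu, runningMean]; field_simp
    rw [this]; ring
  rw [Finset.sum_congr rfl hsplit, Finset.sum_add_distrib, ← Finset.mul_sum]
  refine (abs_add_le _ _).trans (add_le_add ?_ ?_)
  · rw [abs_mul, abs_of_nonneg hX, mul_comm]
    exact mul_le_mul_of_nonneg_right hmain hX
  · refine (Finset.abs_sum_le_sum_abs _ _).trans ?_
    refine (Finset.sum_le_card_nsmul _ _ (3 * V) fun d hd => ?_).trans ?_
    · rw [Finset.mem_Ioc] at hd
      rw [abs_mul, abs_mul]
      calc |f d| * (|K d - X / d| * |u d|) ≤ 1 * (3 * V) := by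
            gcongr
            · exact hf d
            · exact hKX d hd.1 hd.2
            · exact huV d hd.1 hd.2
        _ = 3 * V := one_mul _
    · rw [Nat.card_Ioc, nsmul_eq_mul, mul_comm]
      gcongr
      omega

end

/-! ### Weighted sawtooth sums over all scales -/

/-- Writing the fractional part as `x - ⌊x⌋` and dropping the integer `k * p` exhibits a block sum
as a linear function of `k` minus a sum of floors, each monotone or antitone in `k`. -/
theorem sawSum_block_eq (θ φ : ℝ) (p : ℤ) {q : ℕ} (hq : 1 ≤ q) (k : ℕ) :
    sawSum θ (θ * (q * k : ℕ) + φ) q = k * (q * (q * θ - p)) -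
      (∑ r ∈ Finset.range q, (⌊(p : ℝ) * r / q + φ + (q * θ - p) * (r / q + k)⌋ : ℝ) -
        ∑ r ∈ Finset.range q, (θ * r + φ - 1 / 2)) := by
  have hq0 : (q : ℝ) ≠ 0 := by exact_mod_cast (by omega : q ≠ 0)
  have hterm : ∀ r ∈ Finset.range q, Int.fract (θ * r + (θ * (q * k : ℕ) + φ)) - 1 / 2 =
      k * (q * θ - p) - (⌊(p : ℝ) * r / q + φ + (q * θ - p) * (r / q + k)⌋ : ℝ) +
        (θ * r + φ - 1 / 2) := fun r _ => by
    have e : θ * r + (θ * (q * k : ℕ) + φ) =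
        (p : ℝ) * r / q + φ + (q * θ - p) * (r / q + k) + (k * p : ℤ) := by
      push_cast; field_simp; ring
    rw [e, Int.fract_add_intCast, Int.fract]
    field_simp
    ring
  rw [sawSum, Finset.sum_congr rfl hterm, Finset.sum_add_distrib, Finset.sum_sub_distrib,
    Finset.sum_const, Finset.card_range, nsmul_eq_mul]
  ring

theorem monotone_or_antitone_sum_floor (η : ℝ) (q : ℕ) (x y : ℕ → ℝ) (c : ℝ) :
    Monotone (fun k : ℕ => ∑ r ∈ Finset.range q, (⌊x r + η * (y r + k)⌋ : ℝ) - c) ∨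
    Antitone (fun k : ℕ => ∑ r ∈ Finset.range q, (⌊x r + η * (y r + k)⌋ : ℝ) - c) := by
  rcases le_total 0 η with h | h
  · left
    intro k l hkl
    have : (k : ℝ) ≤ l := by exact_mod_cast hkl
    dsimp only
    gcongr
  · right
    intro k l hkl
    have : (k : ℝ) ≤ l := by exact_mod_cast hkl
    dsimp only
    gcongr ?_ - _
    refine Finset.sum_le_sum fun r _ => ?_
    exact_mod_cast Int.floor_mono (by nlinarith)

theorem monotone_or_antitone_natCast_mul (η : ℝ) :
    Monotone (fun k : ℕ => (k : ℝ) * η) ∨ Antitone (fun k : ℕ => (k : ℝ) * η) := by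
  rcases le_total 0 η with h | h
  · left
    intro k l hkl
    have : (k : ℝ) ≤ l := by exact_mod_cast hkl
    dsimp only
    gcongr
  · right
    intro k l hkl
    have : (k : ℝ) ≤ l := by exact_mod_cast hkl
    dsimp only
    nlinarith

/-- The contribution of one scale: the endpoints are those for which the inner sum has at least `q`
and fewer than `q'` terms. Full blocks of length `q` are handled by partial summation; the
incomplete block costs `Z` for each `d`. -/
theorem abs_sum_Ioc_mul_sawSum_le {θ : ℝ} {p : ℤ} {q q' : ℕ} (hq : 1 ≤ q) (hqq : q ≤ q')
    (hpq : IsCoprime p (q : ℤ)) (happ : |q * θ - p| ≤ 1 / q') {Z : ℝ}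
    (hZ : ∀ φ n, n < q → |sawSum θ φ n| ≤ Z) {f : ℕ → ℝ} {B : ℝ} (hf : ∀ d, |f d| ≤ 1)
    (hB : ∀ n, |∑ d ∈ Finset.Ioc 0 n, f d / d| ≤ B) (hB1 : 1 ≤ B) {m c : ℕ} (hc : 1 ≤ c)
    (hcm : c ≤ m) (Y : ℕ) (φ : ℝ) :
    |∑ d ∈ Finset.Ioc (Y / ((q' - 1) * m + c)) (Y / ((q - 1) * m + c)),
      f d * sawSum θ φ ((Y / d + m - c) / m)| ≤ (49 * B + Z) * (Y / q) := by
  have hq0 : (0 : ℝ) < q := by exact_mod_cast hq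
  have hq'0 : (0 : ℝ) < q' := by exact_mod_cast hq.trans hqq
  have hm : 1 ≤ m := hc.trans hcm
  have hm0 : (0 : ℝ) < m := by exact_mod_cast hm
  have hwq : q ≤ (q - 1) * m + c := by
    obtain ⟨j, rfl⟩ : ∃ j, q = j + 1 := ⟨q - 1, by omega⟩
    simp only [Nat.add_sub_cancel]; nlinarith
  have happ' : |q * θ - p| ≤ 1 / q := happ.trans
    (one_div_le_one_div_of_le hq0 (by exact_mod_cast hqq))
  have hZ0 : 0 ≤ Z := (abs_nonneg _).trans (hZ 0 0 (by omega))
  set ν : ℕ → ℕ := fun d => (Y / d + m - c) / m with hν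
  set y := Y / ((q - 1) * m + c) with hy
  set x := Y / ((q' - 1) * m + c) with hx
  have hYy : (y : ℝ) ≤ Y / q := by
    refine Nat.cast_div_le.trans ?_
    have : (q : ℝ) ≤ ((q - 1) * m + c : ℕ) := by exact_mod_cast hwq
    gcongr
  have hνlo : ∀ d, x < d → d ≤ y → q ≤ ν d := fun d h1 h2 => by
    have hd : 0 < d := Nat.zero_lt_of_lt h1
    rw [hy, Nat.le_div_iff_mul_le (by omega)] at h2
    have h3 : (q - 1) * m + c ≤ Y / d := by rw [Nat.le_div_iff_mul_le hd, mul_comm]; exact h2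
    change q ≤ (Y / d + m - c) / m
    rw [Nat.le_div_iff_mul_le hm]
    obtain ⟨j, rfl⟩ : ∃ j, q = j + 1 := ⟨q - 1, by omega⟩
    simp only [Nat.add_sub_cancel] at h3
    rw [Nat.add_mul, one_mul]
    omega
  have hνhi : ∀ d, x < d → d ≤ y → ν d < q' := fun d h1 h2 => by
    have hd : 0 < d := Nat.zero_lt_of_lt h1
    rw [hx, Nat.div_lt_iff_lt_mul (by omega)] at h1
    have h3 : Y / d < (q' - 1) * m + c := by rw [Nat.div_lt_iff_lt_mul hd, mul_comm]; exact h1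
    change (Y / d + m - c) / m < q'
    rw [Nat.div_lt_iff_lt_mul hm]
    obtain ⟨j, hj⟩ : ∃ j, q' = j + 1 := ⟨q' - 1, by omega⟩
    rw [hj] at h3 ⊢
    simp only [Nat.add_sub_cancel] at h3
    rw [Nat.add_mul, one_mul]
    omega
  have hKq : ∀ d, x < d → d ≤ y → ∀ k < ν d / q, k * q ≤ q' := fun d h1 h2 k hk => by
    have h3 := hνhi d h1 h2
    have h4 : k * q ≤ ν d / q * q := Nat.mul_le_mul_right _ hk.le
    have h5 := Nat.div_mul_le_self (ν d) q
    omega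
  set η : ℝ := q * θ - p with hη
  set b₁ : ℕ → ℝ := fun k => k * (q * η) with hb₁
  set b₂ : ℕ → ℝ := fun k => ∑ r ∈ Finset.range q, (⌊(p : ℝ) * r / q + φ + η * (r / q + k)⌋ : ℝ) -
        ∑ r ∈ Finset.range q, (θ * r + φ - 1 / 2) with hb₂
  have hblock : ∀ k : ℕ, sawSum θ (θ * (q * k : ℕ) + φ) q = b₁ k - b₂ k := fun k =>
    sawSum_block_eq θ φ p hq k
  -- The linear part stays bounded because the approximation is as good as `1 / q'` while `k * q ≤
  -- q'`.
  have hb₁V : ∀ d, x < d → d ≤ y → ∀ k < ν d / q, |b₁ k| ≤ 1 := fun d h1 h2 k hk => by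
    have h3 : (k : ℝ) * q ≤ q' := by exact_mod_cast hKq d h1 h2 k hk
    change |(k : ℝ) * (q * η)| ≤ 1
    rw [← mul_assoc, abs_mul, abs_of_nonneg (by positivity)]
    calc (k : ℝ) * q * |η| ≤ q' * (1 / q') := by gcongr
      _ = 1 := by field_simp
  -- The bound 6 is 5 for the block sum plus 1 for the linear part.
  have hb₂V : ∀ d, x < d → d ≤ y → ∀ k < ν d / q, |b₂ k| ≤ 6 := fun d h1 h2 k hk => by
    have h3 := hb₁V d h1 h2 k hk
    have h4 := abs_sawSum_den_le hq hpq happ' (θ * (q * k : ℕ) + φ)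
    rw [hblock] at h4
    rw [abs_le] at h3 h4 ⊢
    constructor <;> linarith
  set X : ℝ := Y / (m * q) with hX
  have hX0 : 0 ≤ X := by positivity
  have hXle : X ≤ Y / q := by
    rw [hX]
    have : (1 : ℝ) ≤ m := by exact_mod_cast hm
    gcongr
    nlinarith
  have hK1 : ∀ d, x < d → d ≤ y → 1 ≤ ν d / q := fun d h1 h2 =>
    (Nat.one_le_div_iff hq).2 (hνlo d h1 h2)
  have hKX : ∀ d, x < d → d ≤ y → |((ν d / q : ℕ) : ℝ) - X / d| ≤ 3 := fun d h1 h2 => by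
    have hd0 : (0 : ℝ) < d := by exact_mod_cast (Nat.zero_lt_of_lt h1)
    have hcm' : (c : ℝ) ≤ m := by exact_mod_cast hcm
    have hc0 : (0 : ℝ) ≤ c := by positivity
    have hd1 : 0 < d := Nat.zero_lt_of_lt h1
    have a1 : ((Y / d : ℕ) : ℝ) ≤ Y / d := Nat.cast_div_le
    have a2 : (Y : ℝ) / d < (Y / d : ℕ) + 1 := by
      rw [div_lt_iff₀ hd0]; exact_mod_cast Nat.lt_mul_of_div_lt (Nat.lt_succ_self (Y / d)) hd1
    have a3 : ((Y / d + m - c : ℕ) : ℝ) = (Y / d : ℕ) + m - c := by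
      rw [Nat.cast_sub (hcm.trans (Nat.le_add_left _ _))]; push_cast; ring
    have b1 : (ν d : ℝ) ≤ (Y / d + m - c : ℕ) / m := Nat.cast_div_le
    have b2 : ((Y / d + m - c : ℕ) : ℝ) / m < ν d + 1 := by
      rw [div_lt_iff₀ hm0]
      exact_mod_cast Nat.lt_mul_of_div_lt (Nat.lt_succ_self ((Y / d + m - c) / m)) hm
    have c1 : ((ν d / q : ℕ) : ℝ) ≤ ν d / q := Nat.cast_div_le
    have c2 : (ν d : ℝ) / q < (ν d / q : ℕ) + 1 := by
      rw [div_lt_iff₀ hq0]; exact_mod_cast Nat.lt_mul_of_div_lt (Nat.lt_succ_self (ν d / q)) hq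
    rw [a3] at b1 b2
    have hm1 : (1 : ℝ) ≤ m := by exact_mod_cast hm
    have hq1 : (1 : ℝ) ≤ q := by exact_mod_cast hq
    rw [le_div_iff₀ hm0] at b1
    rw [div_lt_iff₀ hm0] at b2
    rw [le_div_iff₀ hq0] at c1
    rw [div_lt_iff₀ hq0] at c2
    have hXd : X / d = Y / d / (m * q) := by rw [hX]; field_simp
    rw [hXd, abs_le]
    constructor
    · rw [neg_le_sub_iff_le_add, div_le_iff₀ (by positivity)]
      nlinarith [mul_lt_mul_of_pos_right c2 hm0, mul_le_mul hm1 hq1 zero_le_one hm0.le]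
    · rw [sub_le_iff_le_add, add_comm, ← sub_le_iff_le_add, le_div_iff₀ (by positivity)]
      nlinarith [mul_le_mul_of_nonneg_right c1 hm0.le, mul_le_mul hm1 hq1 zero_le_one hm0.le]
  have hKanti : ∀ d, x < d → d < y → ν (d + 1) / q ≤ ν d / q := fun d h1 h2 => by
    have : Y / (d + 1) ≤ Y / d := Nat.div_le_div_left (Nat.le_succ d) (Nat.zero_lt_of_lt h1)
    exact Nat.div_le_div_right (Nat.div_le_div_right (Nat.sub_le_sub_right (Nat.add_le_add_right this m) c))
  have hsplit : ∀ d ∈ Finset.Ioc x y, f d * sawSum θ φ (ν d) =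
      f d * ∑ k ∈ Finset.range (ν d / q), b₁ k - f d * ∑ k ∈ Finset.range (ν d / q), b₂ k +
      f d * sawSum θ (θ * (q * (ν d / q) : ℕ) + φ) (ν d % q) := fun d _ => by
    conv_lhs => rw [← Nat.div_add_mod (ν d) q, sawSum_mul_add]
    simp only [hblock, Finset.sum_sub_distrib]
    ring
  rw [Finset.sum_congr rfl hsplit, Finset.sum_add_distrib, Finset.sum_sub_distrib]
  have t1 := abs_sum_Ioc_mul_sum_range_le hf hB (monotone_or_antitone_natCast_mul (q * η)) hX0
    zero_le_one hK1 hb₁V hKX hKanti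
  have t2 := abs_sum_Ioc_mul_sum_range_le hf hB (monotone_or_antitone_sum_floor η q
    (fun r => (p : ℝ) * r / q + φ) (fun r => (r : ℝ) / q)
    (∑ r ∈ Finset.range q, (θ * r + φ - 1 / 2))) hX0
    (by norm_num : (0 : ℝ) ≤ 6) hK1 hb₂V hKX hKanti
  have t3 : |∑ d ∈ Finset.Ioc x y, f d * sawSum θ (θ * (q * (ν d / q) : ℕ) + φ) (ν d % q)| ≤
      Z * (Y / q) := by
    refine (Finset.abs_sum_le_sum_abs _ _).trans ?_
    refine (Finset.sum_le_card_nsmul _ _ Z fun d hd => ?_).trans ?_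
    · rw [abs_mul]
      calc _ ≤ 1 * Z := by
            gcongr
            · exact hf d
            · exact hZ _ _ (Nat.mod_lt _ hq)
        _ = Z := one_mul _
    · rw [Nat.card_Ioc, nsmul_eq_mul, mul_comm]
      refine mul_le_mul_of_nonneg_left (le_trans ?_ hYy) hZ0
      exact_mod_cast Nat.sub_le y x
  refine (abs_add_le _ _).trans ?_
  refine (add_le_add ((abs_sub _ _).trans (add_le_add t1 t2)) t3).trans ?_
  -- The two applications, with `V = 1` and `V = 6`, give `28 * B * X + 21 * y`, hence the constant
  -- 49.
  have hYq0 : (0 : ℝ) ≤ Y / q := by positivity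
  have hBX : B * X ≤ B * (Y / q) := by gcongr
  have hBY : 1 * (Y / q : ℝ) ≤ B * (Y / q) := by gcongr
  nlinarith

/-- The sawtooth sums along a linear progression, averaged against a bounded multiplicative-type
weight `f` whose logarithmic partial sums are bounded, are of linear size. -/
theorem abs_sum_mul_sawSum_le {θ : ℝ} (hθ : Irrational θ) {f : ℕ → ℝ} {B : ℝ}
    (hf : ∀ d, |f d| ≤ 1) (hB : ∀ n, |∑ d ∈ Finset.Ioc 0 n, f d / d| ≤ B) (hB1 : 1 ≤ B)
    {m c : ℕ} (hc : 1 ≤ c) (hcm : c ≤ m) (Y : ℕ) (φ : ℝ) :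
    |∑ d ∈ Finset.Ioc 0 Y, f d * sawSum θ φ ((Y / d + m - c) / m)| ≤ 286 * B * Y := by
  set q := recordDen hθ with hq
  have hm : 1 ≤ m := hc.trans hcm
  have hq1 : ∀ i, 1 ≤ q i := one_le_recordDen hθ
  have hqm : StrictMono q := recordDen_strictMono hθ
  set w : ℕ → ℕ := fun i => Y / ((q i - 1) * m + c) with hw
  have hw_anti : ∀ i, w (i + 1) ≤ w i := fun i => by
    have h1 := hqm (Nat.lt_succ_self i)
    have h2 : (q i - 1) * m ≤ (q (i + 1) - 1) * m := Nat.mul_le_mul_right _ (by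
      simp only [Nat.succ_eq_add_one] at h1; omega)
    exact Nat.div_le_div_left (by omega) (by omega)
  have hlevel : ∀ I, |∑ d ∈ Finset.Ioc (w I) (w 0), f d * sawSum θ φ ((Y / d + m - c) / m)| ≤
      Y * (49 * B * ∑ i ∈ Finset.range I, (1 : ℝ) / q i +
        ∑ i ∈ Finset.range I, remainderBound q i / q i) := by
    intro I
    induction I with
    | zero => simp
    | succ I ih =>
      have hle : w I ≤ w 0 := antitone_nat_of_succ_le hw_anti (Nat.zero_le I)
      rw [← Finset.sum_Ioc_consecutive _ (hw_anti I) hle, Finset.sum_range_succ,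
        Finset.sum_range_succ]
      have := abs_sum_Ioc_mul_sawSum_le (hq1 I) (hqm (Nat.lt_succ_self I)).le
        (recordDen_isCoprime hθ I) (distInt_recordDen_le hθ I)
        (fun φ n hn => abs_sawSum_le_remainderBound hθ I φ n hn) hf hB hB1 hc hcm Y φ
      refine (abs_add_le _ _).trans ((add_le_add this ih).trans (le_of_eq ?_))
      ring
  obtain ⟨I, hI⟩ : ∃ I, w I = 0 := by
    refine ⟨Y + 1, Nat.div_eq_of_lt ?_⟩
    have h1 : Y + 1 ≤ q (Y + 1) := hqm.le_apply
    have h2 : (q (Y + 1) - 1) * 1 ≤ (q (Y + 1) - 1) * m := Nat.mul_le_mul_left _ hm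
    omega
  have hsum : ∑ d ∈ Finset.Ioc 0 Y, f d * sawSum θ φ ((Y / d + m - c) / m) =
      ∑ d ∈ Finset.Ioc (w I) (w 0), f d * sawSum θ φ ((Y / d + m - c) / m) := by
    have hw0 : w 0 = Y / c := by simp [hw, hq, recordDen]
    rw [hI, hw0]
    symm
    -- For `d` beyond `Y / c` the progression has no term up to `Y / d`, so the inner sum is empty.
    refine Finset.sum_subset (Finset.Ioc_subset_Ioc_right (Nat.div_le_self _ _)) ?_
    intro d hd hd'
    rw [Finset.mem_Ioc] at hd hd'
    have h1 : Y / c < d := by by_contra! h; exact hd' ⟨hd.1, h⟩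
    have h2 : Y / d < c := by
      rw [Nat.div_lt_iff_lt_mul (by omega)] at h1 ⊢
      rwa [mul_comm]
    rw [Nat.div_eq_of_lt (by omega)]
    simp [sawSum]
  rw [hsum]
  refine (hlevel I).trans ?_
  -- The final constant is `49 * 4 + 90 = 286`, the 90 being absorbed by `1 ≤ B`.
  have s1 := sum_inv_le_of_doubling hq1 (two_mul_recordDen_le hθ) I
  have s2 := sum_remainderBound_div_le (q := q) rfl hq1 hqm.monotone (two_mul_recordDen_le hθ) I
  have hY : (0 : ℝ) ≤ Y := by positivity
  rw [mul_comm]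
  refine mul_le_mul_of_nonneg_right ?_ hY
  nlinarith

/-! ### Logarithmic Möbius sums in residue classes, with sieving -/

open ArithmeticFunction in
/-- The logarithmic partial sum of `μ w` over the integers without prime factor in `s`. -/
noncomputable def siftedMoebiusSum (w : ℕ → ℂ) (s : Finset ℕ) (x : ℕ) : ℂ :=
  ∑ d ∈ Finset.Ioc 0 x, if ∀ p ∈ s, ¬ p ∣ d then (moebius d : ℂ) * w d / d else 0

theorem moebius_prime_mul {p : ℕ} (hp : p.Prime) (e : ℕ) :
    ArithmeticFunction.moebius (p * e) = if p ∣ e then 0 else -ArithmeticFunction.moebius e := by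
  split_ifs with h
  · obtain ⟨k, rfl⟩ := h
    apply ArithmeticFunction.moebius_eq_zero_of_not_squarefree
    intro hsq
    have := hsq p ⟨k, by ring⟩
    exact hp.one_lt.ne' (Nat.isUnit_iff.1 this)
  · rw [ArithmeticFunction.isMultiplicative_moebius.map_mul_of_coprime
      ((Nat.Prime.coprime_iff_not_dvd hp).2 h), ArithmeticFunction.moebius_apply_prime hp, neg_one_mul]

theorem filter_dvd_Ioc_eq_image {p : ℕ} (hp : 0 < p) (x : ℕ) :
    (Finset.Ioc 0 x).filter (p ∣ ·) = (Finset.Ioc 0 (x / p)).image (p * ·) := by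
  ext d
  simp only [Finset.mem_filter, Finset.mem_Ioc, Finset.mem_image]
  constructor
  · rintro ⟨⟨h1, h2⟩, e, rfl⟩
    refine ⟨e, ⟨Nat.pos_of_mul_pos_left h1, ?_⟩, rfl⟩
    rw [Nat.le_div_iff_mul_le hp, mul_comm]; exact h2
  · rintro ⟨e, ⟨h1, h2⟩, rfl⟩
    rw [Nat.le_div_iff_mul_le hp, mul_comm] at h2
    exact ⟨⟨Nat.mul_pos hp h1, h2⟩, dvd_mul_right _ _⟩

theorem siftedMoebiusSum_eq_sub {w : ℕ → ℂ} (hw : ∀ a b, w (a * b) = w a * w b) {s : Finset ℕ}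
    (hs : ∀ p ∈ s, p.Prime) {p : ℕ} (hp : p.Prime) (hps : p ∉ s) (x : ℕ) :
    siftedMoebiusSum w s x = siftedMoebiusSum w (insert p s) x -
      w p / p * siftedMoebiusSum w (insert p s) (x / p) := by
  rw [siftedMoebiusSum, ← Finset.sum_filter_add_sum_filter_not _ (p ∣ ·),
    filter_dvd_Ioc_eq_image hp.pos, Finset.sum_image (fun a _ b _ h =>
      Nat.eq_of_mul_eq_mul_left hp.pos h), siftedMoebiusSum, siftedMoebiusSum, Finset.mul_sum,
      add_comm, sub_eq_add_neg, ← Finset.sum_neg_distrib]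
  congr 1
  · rw [Finset.sum_filter]
    refine Finset.sum_congr rfl fun d _ => ?_
    simp only [Finset.mem_insert, forall_eq_or_imp]
    by_cases h : p ∣ d <;> simp [h]
  · refine Finset.sum_congr rfl fun e he => ?_
    have he0 : (e : ℂ) ≠ 0 := by
      rw [Finset.mem_Ioc] at he; exact_mod_cast (by omega : e ≠ 0)
    have hp0 : (p : ℂ) ≠ 0 := by exact_mod_cast hp.ne_zero
    have hiff : (∀ r ∈ s, ¬ r ∣ p * e) ↔ ∀ r ∈ s, ¬ r ∣ e := by
      refine forall₂_congr fun r hr => not_congr ?_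
      rw [(hs r hr).dvd_mul]
      refine ⟨fun h => h.resolve_left fun h1 => hps ?_, Or.inr⟩
      rwa [← (Nat.prime_dvd_prime_iff_eq (hs r hr) hp).1 h1]
    simp only [Finset.mem_insert, forall_eq_or_imp, hiff, moebius_prime_mul hp, hw]
    by_cases h : p ∣ e
    · simp [h]
    · by_cases h' : ∀ r ∈ s, ¬ r ∣ e
      · simp only [h, not_false_eq_true, true_and, if_false]
        rw [if_pos h', if_pos h']
        push_cast
        field_simp
      · simp only [h', and_false, if_false, mul_zero, neg_zero]

/-- Sifting by one more prime `p` gives `T(x) = S(x) + (w p / p) T(x / p)`. The coefficient is at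
most `1 / 2`, so by induction on `x` the bound at most doubles. -/
theorem norm_siftedMoebiusSum_le {w : ℕ → ℂ} (hw : ∀ a b, w (a * b) = w a * w b)
    (hw1 : ∀ a, ‖w a‖ ≤ 1) {B : ℝ} (hB : ∀ x, ‖siftedMoebiusSum w ∅ x‖ ≤ B) (s : Finset ℕ)
    (hs : ∀ p ∈ s, p.Prime) (x : ℕ) : ‖siftedMoebiusSum w s x‖ ≤ 2 ^ s.card * B := by
  induction s using Finset.induction_on generalizing x with
  | empty => simpa using hB x
  | insert p s hps ih =>
    have hs' : ∀ r ∈ s, r.Prime := fun r hr => hs r (Finset.mem_insert_of_mem hr)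
    have hp := hs p (Finset.mem_insert_self p s)
    have ih := ih hs'
    rw [Finset.card_insert_of_notMem hps]
    have hB0 : 0 ≤ B := (norm_nonneg _).trans (hB 0)
    induction x using Nat.strong_induction_on with
    | _ x ihx =>
      rcases Nat.eq_zero_or_pos x with rfl | hx
      · simp only [siftedMoebiusSum, Finset.Ioc_self, Finset.sum_empty, norm_zero]; positivity
      · have h1 := siftedMoebiusSum_eq_sub hw hs' hp hps x
        have h2 := ihx (x / p) (Nat.div_lt_self hx hp.one_lt)
        have h3 := ih x
        have h4 : siftedMoebiusSum w (insert p s) x = siftedMoebiusSum w s x +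
          w p / p * siftedMoebiusSum w (insert p s) (x / p) := by rw [h1]; ring
        have h5 : ‖w p / p‖ ≤ 1 / 2 := by
          rw [norm_div, Complex.norm_natCast]
          have : (2 : ℝ) ≤ p := by exact_mod_cast hp.two_le
          exact div_le_div₀ zero_le_one (hw1 p) (by norm_num) this
        rw [h4]
        calc _ ≤ ‖siftedMoebiusSum w s x‖ +
              ‖w p / p‖ * ‖siftedMoebiusSum w (insert p s) (x / p)‖ :=
              (norm_add_le _ _).trans (by rw [norm_mul])
          _ ≤ 2 ^ s.card * B + 1 / 2 * (2 ^ (s.card + 1) * B) := by gcongr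
          _ = 2 ^ (s.card + 1) * B := by ring

/-- Summing `μ * ζ = 1` gives `1 = ∑ μ(n) ⌊x / n⌋`; removing the floors costs at most 1 for each
`n`. -/
theorem norm_siftedMoebiusSum_one_le (x : ℕ) : ‖siftedMoebiusSum 1 ∅ x‖ ≤ 2 := by
  rcases Nat.eq_zero_or_pos x with rfl | hx
  · simp [siftedMoebiusSum]
  have hx0 : (0 : ℝ) < x := by exact_mod_cast hx
  have h1 := ArithmeticFunction.sum_Ioc_mul_zeta_eq_sum
    (ArithmeticFunction.moebius : ArithmeticFunction ℂ) x
  rw [ArithmeticFunction.coe_moebius_mul_coe_zeta] at h1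
  have h2 : ∑ n ∈ Finset.Ioc 0 x, (1 : ArithmeticFunction ℂ) n = 1 := by
    simp only [ArithmeticFunction.one_apply]
    rw [Finset.sum_ite_eq', if_pos]
    rw [Finset.mem_Ioc]; omega
  rw [h2] at h1
  have h3 : (x : ℂ) * siftedMoebiusSum 1 ∅ x = 1 + ∑ n ∈ Finset.Ioc 0 x,
      (ArithmeticFunction.moebius n : ℂ) * ((x : ℂ) / n - ((x / n : ℕ) : ℂ)) := by
    rw [h1, siftedMoebiusSum, Finset.mul_sum, ← Finset.sum_add_distrib]
    refine Finset.sum_congr rfl fun n _ => ?_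
    simp only [Finset.notMem_empty, IsEmpty.forall_iff, implies_true, if_true, Pi.one_apply,
      ArithmeticFunction.intCoe_apply]
    ring
  have h4 : ‖(x : ℂ) * siftedMoebiusSum 1 ∅ x‖ ≤ 1 + x := by
    rw [h3]
    refine (norm_add_le _ _).trans ?_
    rw [norm_one]
    gcongr
    refine (norm_sum_le _ _).trans ((Finset.sum_le_card_nsmul _ _ 1 fun n hn => ?_).trans ?_)
    · rw [Finset.mem_Ioc] at hn
      have hn0 : (0 : ℝ) < n := by exact_mod_cast hn.1
      have a1 : ((x / n : ℕ) : ℝ) ≤ x / n := Nat.cast_div_le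
      have a2 : (x : ℝ) / n < (x / n : ℕ) + 1 := by
        rw [div_lt_iff₀ hn0]
        exact_mod_cast Nat.lt_mul_of_div_lt (Nat.lt_succ_self (x / n)) hn.1
      have a3 : ‖(x : ℂ) / n - ((x / n : ℕ) : ℂ)‖ ≤ 1 := by
        rw [show (x : ℂ) / n - ((x / n : ℕ) : ℂ) = (((x : ℝ) / n - (x / n : ℕ) : ℝ) : ℂ) by
          push_cast; ring, Complex.norm_real, Real.norm_eq_abs, abs_le]
        constructor <;> linarith
      have a4 : ‖(ArithmeticFunction.moebius n : ℂ)‖ ≤ 1 := by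
        rw [Complex.norm_intCast]
        exact_mod_cast ArithmeticFunction.abs_moebius_le_one
      rw [norm_mul]
      exact mul_le_one₀ a4 (norm_nonneg _) a3
    · simp
  rw [norm_mul, Complex.norm_natCast] at h4
  have : (1 : ℝ) ≤ x := by exact_mod_cast hx
  by_contra! h
  nlinarith

theorem norm_sum_range_smul_le {a : ℕ → ℂ} {A : ℝ} (ha : ∀ n, ‖∑ i ∈ Finset.range n, a i‖ ≤ A)
    {w : ℕ → ℝ} (hw : Antitone w) (hw0 : ∀ n, 0 ≤ w n) (n : ℕ) :
    ‖∑ i ∈ Finset.range n, (w i : ℂ) * a i‖ ≤ A * w 0 := by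
  have key : ‖∑ i ∈ Finset.range n, (w i : ℂ) * a i - w n * ∑ i ∈ Finset.range n, a i‖ ≤
      A * (w 0 - w n) := by
    induction n with
    | zero => simp
    | succ n ih =>
      have h := hw (Nat.le_succ n)
      simp only [Nat.succ_eq_add_one] at h
      rw [Finset.sum_range_succ,
        show ∑ i ∈ Finset.range n, (w i : ℂ) * a i + w n * a n -
          w (n + 1) * ∑ i ∈ Finset.range (n + 1), a i =
          (∑ i ∈ Finset.range n, (w i : ℂ) * a i - w n * ∑ i ∈ Finset.range n, a i) +
          ((w n - w (n + 1) : ℝ) : ℂ) * ∑ i ∈ Finset.range (n + 1), a i by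
          rw [Finset.sum_range_succ]; push_cast; ring]
      refine (norm_add_le _ _).trans ?_
      have h2 : ‖((w n - w (n + 1) : ℝ) : ℂ) * ∑ i ∈ Finset.range (n + 1), a i‖ ≤
          (w n - w (n + 1)) * A := by
        rw [norm_mul, Complex.norm_real, Real.norm_eq_abs, abs_of_nonneg (by linarith)]
        exact mul_le_mul_of_nonneg_left (ha _) (by linarith)
      linarith
  have h3 : ‖(w n : ℂ) * ∑ i ∈ Finset.range n, a i‖ ≤ w n * A := by
    rw [norm_mul, Complex.norm_real, Real.norm_eq_abs, abs_of_nonneg (hw0 n)]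
    exact mul_le_mul_of_nonneg_left (ha _) (hw0 n)
  have h4 := norm_add_le
    (∑ i ∈ Finset.range n, (w i : ℂ) * a i - w n * ∑ i ∈ Finset.range n, a i)
    ((w n : ℂ) * ∑ i ∈ Finset.range n, a i)
  rw [sub_add_cancel] at h4
  linarith

theorem sum_range_character_eq_zero {m : ℕ} [NeZero m] {χ : DirichletCharacter ℂ m} (hχ : χ ≠ 1)
    (y : ℕ) : ∑ i ∈ Finset.range m, χ ((y + i : ℕ) : ZMod m) = 0 := by
  rw [← MulChar.sum_eq_zero_of_ne_one hχ]
  refine Finset.sum_bij (fun i _ => ((y + i : ℕ) : ZMod m)) (fun _ _ => Finset.mem_univ _) ?_ ?_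
    (fun _ _ => rfl)
  · intro i hi j hj h
    rw [Finset.mem_range] at hi hj
    push_cast at h
    have := add_left_cancel h
    rw [ZMod.natCast_eq_natCast_iff'] at this
    rwa [Nat.mod_eq_of_lt hi, Nat.mod_eq_of_lt hj] at this
  · intro z _
    refine ⟨(z - y).val, Finset.mem_range.2 (ZMod.val_lt _), ?_⟩
    push_cast
    rw [ZMod.natCast_zmod_val]; ring

theorem norm_sum_range_character_le {m : ℕ} [NeZero m] {χ : DirichletCharacter ℂ m} (hχ : χ ≠ 1)
    (n y : ℕ) : ‖∑ i ∈ Finset.range n, χ ((y + i : ℕ) : ZMod m)‖ ≤ m := by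
  induction n using Nat.strong_induction_on generalizing y with
  | _ n ih =>
    rcases lt_or_ge n m with h | h
    · refine (norm_sum_le _ _).trans ((Finset.sum_le_card_nsmul _ _ 1
        fun i _ => χ.norm_le_one _).trans ?_)
      simp only [Finset.card_range, nsmul_eq_mul, mul_one]
      exact_mod_cast h.le
    · obtain ⟨k, rfl⟩ := Nat.exists_eq_add_of_le h
      rw [Finset.sum_range_add, sum_range_character_eq_zero hχ, zero_add]
      have := ih k (by have := NeZero.pos m; omega) (y + m)
      simpa [add_assoc] using this

/-- Partial summation: character sums over any interval are at most `m` in norm, and the weights `n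
^ (-s)` decrease. The bound is independent of `s`, which permits the limit `s → 1`. -/
theorem norm_LSeries_sub_sum_le {m : ℕ} [NeZero m] {χ : DirichletCharacter ℂ m} (hχ : χ ≠ 1)
    {s : ℝ} (hs : 1 < s) (y : ℕ) :
    ‖DirichletCharacter.LFunction χ s - ∑ e ∈ Finset.Ioc 0 y, χ e / (e : ℂ) ^ (s : ℂ)‖ ≤
      m / (y + 1) := by
  have hs' : 1 < (s : ℂ).re := by simpa using hs
  rw [DirichletCharacter.LFunction_eq_LSeries χ hs']
  have hsum := (DirichletCharacter.LSeriesSummable_of_one_lt_re χ hs').hasSum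
  have htend := (hsum.tendsto_sum_nat.comp (Filter.tendsto_add_atTop_nat (y + 1))).sub_const
    (∑ e ∈ Finset.Ioc 0 y, χ e / (e : ℂ) ^ (s : ℂ))
  refine le_of_tendsto htend.norm (Filter.Eventually.of_forall fun n => ?_)
  have hz : LSeries.term (fun n => χ n) (s : ℂ) 0 = 0 := LSeries.term_zero _ _
  have hrange : ∑ e ∈ Finset.range (y + 1), LSeries.term (fun n => χ n) (s : ℂ) e =
      ∑ e ∈ Finset.Ioc 0 y, χ e / (e : ℂ) ^ (s : ℂ) := by
    rw [Finset.sum_range_succ', hz, add_zero, ← Finset.sum_image (g := fun i => i + 1)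
      (f := fun e => LSeries.term (fun n => χ n) (s : ℂ) e) (fun a _ b _ h => Nat.succ_injective h)]
    refine Finset.sum_congr ?_ fun e he => ?_
    · ext e
      simp only [Finset.mem_image, Finset.mem_range, Finset.mem_Ioc]
      constructor
      · rintro ⟨a, h, rfl⟩; omega
      · rintro ⟨h1, h2⟩; exact ⟨e - 1, by omega, by omega⟩
    · rw [Finset.mem_Ioc] at he
      rw [LSeries.term_of_ne_zero (by omega)]
  simp only [Function.comp_apply]
  rw [show n + (y + 1) = (y + 1) + n by ring, Finset.sum_range_add, hrange, add_sub_cancel_left]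
  have hterm : ∀ i ∈ Finset.range n, LSeries.term (fun n => χ n) (s : ℂ) (y + 1 + i) =
      ((((y + 1 + i : ℕ) : ℝ) ^ (-s) : ℝ) : ℂ) * χ ((y + 1 + i : ℕ) : ZMod m) := fun i _ => by
    rw [LSeries.term_of_ne_zero (by omega), Complex.ofReal_cpow (by positivity),
      Complex.ofReal_neg, Complex.cpow_neg, Complex.ofReal_natCast]
    rw [div_eq_inv_mul]
  rw [Finset.sum_congr rfl hterm]
  have hanti : Antitone fun i : ℕ => ((y + 1 + i : ℕ) : ℝ) ^ (-s) := by
    intro i j hij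
    have : ((y + 1 + i : ℕ) : ℝ) ≤ ((y + 1 + j : ℕ) : ℝ) := by exact_mod_cast (by omega)
    exact Real.rpow_le_rpow_of_nonpos (by positivity) this (by linarith)
  refine (norm_sum_range_smul_le (fun n => norm_sum_range_character_le hχ n (y + 1)) hanti
    (fun n => by positivity) n).trans ?_
  rw [div_eq_mul_inv]
  gcongr
  simp only [add_zero]
  push_cast
  rw [← Real.rpow_neg_one]
  exact Real.rpow_le_rpow_of_exponent_le (by linarith [Nat.cast_nonneg (α := ℝ) y]) (by linarith)

theorem norm_LFunction_one_sub_sum_le {m : ℕ} [NeZero m] {χ : DirichletCharacter ℂ m}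
    (hχ : χ ≠ 1) (y : ℕ) :
    ‖DirichletCharacter.LFunction χ 1 - ∑ e ∈ Finset.Ioc 0 y, χ e / (e : ℂ)‖ ≤ m / (y + 1) := by
  have hof : Filter.Tendsto (fun s : ℝ => (s : ℂ)) (nhdsWithin 1 (Set.Ioi 1)) (nhds 1) := by
    have : Filter.Tendsto (fun s : ℝ => (s : ℂ)) (nhds 1) (nhds ((1 : ℝ) : ℂ)) :=
      Complex.continuous_ofReal.tendsto 1
    rw [Complex.ofReal_one] at this
    exact this.mono_left nhdsWithin_le_nhds
  have h1 := ((DirichletCharacter.differentiable_LFunction hχ).continuous.tendsto 1).comp hof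
  have h2 : Filter.Tendsto (fun s : ℝ => ∑ e ∈ Finset.Ioc 0 y, χ e / (e : ℂ) ^ (s : ℂ))
      (nhdsWithin 1 (Set.Ioi 1)) (nhds (∑ e ∈ Finset.Ioc 0 y, χ e / (e : ℂ))) := by
    refine tendsto_finsetSum _ fun e he => ?_
    rw [Finset.mem_Ioc] at he
    have he0 : (e : ℂ) ≠ 0 := by exact_mod_cast (by omega : e ≠ 0)
    have h3 : Filter.Tendsto (fun s : ℝ => (e : ℂ) ^ (s : ℂ)) (nhdsWithin 1 (Set.Ioi 1))
        (nhds ((e : ℂ) ^ (1 : ℂ))) :=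
      ((continuousAt_const_cpow he0).tendsto).comp hof
    rw [Complex.cpow_one] at h3
    exact tendsto_const_nhds.div h3 he0
  refine le_of_tendsto (h1.sub h2).norm ?_
  filter_upwards [self_mem_nhdsWithin] with s hs
  exact norm_LSeries_sub_sum_le hχ hs y

/-- Since `μ χ / n` and `χ / n` are Dirichlet inverses, `1 = ∑ f(n) ∑_{e ≤ x/n} χ(e) / e`. Replacing
each inner sum by `L(1, χ)` costs at most `m / x` for each of the `x` terms. -/
theorem norm_siftedMoebiusSum_character_le {m : ℕ} [NeZero m] {χ : DirichletCharacter ℂ m}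
    (hχ : χ ≠ 1) (x : ℕ) : ‖siftedMoebiusSum (fun n => χ n) ∅ x‖ ≤
      (1 + m) / ‖DirichletCharacter.LFunction χ 1‖ := by
  have hL := DirichletCharacter.LFunction_apply_one_ne_zero hχ
  rw [le_div_iff₀ (norm_pos_iff.2 hL), ← norm_mul]
  rcases Nat.eq_zero_or_pos x with rfl | hx
  · simp only [siftedMoebiusSum, Finset.Ioc_self, Finset.sum_empty, zero_mul, norm_zero]
    positivity
  set L := DirichletCharacter.LFunction χ 1 with hLdef
  let f : ArithmeticFunction ℂ := ⟨fun d => (ArithmeticFunction.moebius d : ℂ) * χ d / d, by simp⟩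
  let g : ArithmeticFunction ℂ := ⟨fun d => χ d / d, by simp⟩
  have hfg : f * g = 1 := by
    ext n
    rw [ArithmeticFunction.mul_apply]
    have hterm : ∀ z ∈ n.divisorsAntidiagonal, f z.1 * g z.2 =
        χ n / n * ((ArithmeticFunction.moebius : ArithmeticFunction ℂ) z.1 *
          (ArithmeticFunction.zeta : ArithmeticFunction ℂ) z.2) := fun z hz => by
      obtain ⟨hz1, hz2⟩ := Nat.mem_divisorsAntidiagonal.1 hz
      have h0 : z.2 ≠ 0 := by rintro h; rw [h] at hz1; exact hz2 (by simpa using hz1.symm)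
      simp only [f, g, ArithmeticFunction.coe_mk, ArithmeticFunction.intCoe_apply,
        ArithmeticFunction.natCoe_apply, ArithmeticFunction.zeta_apply, h0, if_false]
      rw [← hz1]
      push_cast
      rw [map_mul, mul_one, div_mul_div_comm]
      ring
    rw [Finset.sum_congr rfl hterm, ← Finset.mul_sum, ← ArithmeticFunction.mul_apply,
      ArithmeticFunction.coe_moebius_mul_coe_zeta, ArithmeticFunction.one_apply]
    split_ifs with h
    · simp [h]
    · simp
  have h1 := ArithmeticFunction.sum_Ioc_mul_eq_sum_sum f g x
  have h2 : ∑ n ∈ Finset.Ioc 0 x, (1 : ArithmeticFunction ℂ) n = 1 := by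
    simp only [ArithmeticFunction.one_apply]
    rw [Finset.sum_ite_eq', if_pos]
    rw [Finset.mem_Ioc]; omega
  rw [hfg, h2] at h1
  have h3 : siftedMoebiusSum (fun n => χ n) ∅ x * L = 1 +
      ∑ n ∈ Finset.Ioc 0 x, f n * (L - ∑ e ∈ Finset.Ioc 0 (x / n), χ e / (e : ℂ)) := by
    rw [h1, siftedMoebiusSum, Finset.sum_mul, ← Finset.sum_add_distrib]
    refine Finset.sum_congr rfl fun n _ => ?_
    simp only [Finset.notMem_empty, IsEmpty.forall_iff, implies_true, if_true, f, g,
      ArithmeticFunction.coe_mk]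
    ring
  rw [h3]
  refine (norm_add_le _ _).trans ?_
  rw [norm_one]
  gcongr
  have hx0 : (0 : ℝ) < x := by exact_mod_cast hx
  refine (norm_sum_le _ _).trans ((Finset.sum_le_card_nsmul _ _ ((m : ℝ) / x) fun n hn => ?_).trans ?_)
  · rw [Finset.mem_Ioc] at hn
    have hn0 : (0 : ℝ) < n := by exact_mod_cast hn.1
    have a2 : (x : ℝ) < ((x / n : ℕ) + 1) * n := by
      exact_mod_cast Nat.lt_mul_of_div_lt (Nat.lt_succ_self (x / n)) hn.1
    have a4 : ‖f n‖ ≤ 1 / n := by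
      simp only [f, ArithmeticFunction.coe_mk]
      rw [norm_div, Complex.norm_natCast, norm_mul]
      gcongr
      refine mul_le_one₀ ?_ (norm_nonneg _) (χ.norm_le_one _)
      rw [Complex.norm_intCast]
      exact_mod_cast ArithmeticFunction.abs_moebius_le_one
    have a5 := norm_LFunction_one_sub_sum_le hχ (x / n)
    rw [norm_mul]
    calc _ ≤ 1 / (n : ℝ) * (m / ((x / n : ℕ) + 1)) := by gcongr
      _ = m / (((x / n : ℕ) + 1) * n) := by field_simp
      _ ≤ m / x := by gcongr
  · rw [Nat.card_Ioc, nsmul_eq_mul, Nat.sub_zero]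
    field_simp
    exact le_rfl

/-- For the trivial character the sum is the plain Möbius sum sifted by the primes dividing `m`. -/
theorem exists_bound_siftedMoebiusSum_character {m : ℕ} [NeZero m] (χ : DirichletCharacter ℂ m) :
    ∃ B : ℝ, ∀ x, ‖siftedMoebiusSum (fun n => χ n) ∅ x‖ ≤ B := by
  by_cases hχ : χ = 1
  · refine ⟨2 ^ m.primeFactors.card * 2, fun x => ?_⟩
    have h := norm_siftedMoebiusSum_le (w := 1) (by simp) (by simp) norm_siftedMoebiusSum_one_le
      m.primeFactors (fun p hp => Nat.prime_of_mem_primeFactors hp) x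
    convert h using 2
    rw [siftedMoebiusSum, siftedMoebiusSum]
    refine Finset.sum_congr rfl fun d _ => ?_
    have hiff : (∀ p ∈ m.primeFactors, ¬ p ∣ d) ↔ IsUnit (d : ZMod m) := by
      rw [ZMod.isUnit_iff_coprime]
      constructor
      · intro h
        refine Nat.Coprime.symm (Nat.coprime_of_dvd fun p hp hpm hpd => ?_)
        exact h p (Nat.mem_primeFactors.2 ⟨hp, hpm, NeZero.ne m⟩) hpd
      · intro h p hp hpd
        exact Nat.not_coprime_of_dvd_of_dvd (Nat.prime_of_mem_primeFactors hp).one_lt hpd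
          (Nat.dvd_of_mem_primeFactors hp) h
    simp only [hiff, hχ, Finset.notMem_empty, IsEmpty.forall_iff, implies_true, if_true,
      Pi.one_apply]
    split_ifs with h
    · rw [MulChar.one_apply h]
    · rw [MulChar.map_nonunit _ h]; simp
  · exact ⟨_, norm_siftedMoebiusSum_character_le hχ⟩

/-- Orthogonality of characters. The constant depends on `m` alone; the sieving set enters only
through its cardinality. -/
theorem exists_bound_moebius_progression (m : ℕ) [NeZero m] :
    ∃ B : ℝ, 1 ≤ B ∧ ∀ u : ZMod m, IsUnit u → ∀ s : Finset ℕ, (∀ p ∈ s, p.Prime) → ∀ x : ℕ,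
      |∑ d ∈ Finset.Ioc 0 x, (if (d : ZMod m) = u ∧ ∀ p ∈ s, ¬ p ∣ d then
        (ArithmeticFunction.moebius d : ℝ) else 0) / d| ≤ 2 ^ s.card * B := by
  choose b hb using exists_bound_siftedMoebiusSum_character (m := m)
  have hb0 : ∀ χ, 0 ≤ b χ := fun χ => (norm_nonneg _).trans (hb χ 0)
  refine ⟨1 + ∑ χ, b χ, by linarith [Finset.sum_nonneg fun χ (_ : χ ∈ Finset.univ) => hb0 χ], ?_⟩
  intro u hu s hs x
  set S := ∑ d ∈ Finset.Ioc 0 x, (if (d : ZMod m) = u ∧ ∀ p ∈ s, ¬ p ∣ d then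
        (ArithmeticFunction.moebius d : ℝ) else 0) / d with hS
  have hφ : (1 : ℝ) ≤ m.totient := by exact_mod_cast Nat.totient_pos.2 (NeZero.pos m)
  have hkey : (m.totient : ℂ) * (S : ℂ) =
      ∑ χ : DirichletCharacter ℂ m, χ u⁻¹ * siftedMoebiusSum (fun n => χ n) s x := by
    simp only [siftedMoebiusSum, Finset.mul_sum]
    rw [Finset.sum_comm, hS, Complex.ofReal_sum, Finset.mul_sum]
    refine Finset.sum_congr rfl fun d _ => ?_
    by_cases h : ∀ p ∈ s, ¬ p ∣ d
    · have horth := DirichletCharacter.sum_char_inv_mul_char_eq ℂ hu (d : ZMod m)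
      have : ∑ χ : DirichletCharacter ℂ m, χ u⁻¹ * ((ArithmeticFunction.moebius d : ℂ) * χ d / d)
          = (∑ χ : DirichletCharacter ℂ m, χ u⁻¹ * χ d) * ((ArithmeticFunction.moebius d : ℂ) / d) := by
        rw [Finset.sum_mul]
        exact Finset.sum_congr rfl fun χ _ => by ring
      simp only [if_pos h]
      rw [this, horth]
      by_cases h' : (d : ZMod m) = u
      · rw [if_pos ⟨h', h⟩, if_pos h'.symm]; push_cast; ring
      · rw [if_neg (fun h'' => h' h''.1), if_neg (fun h'' => h' h''.symm)]; simp
    · simp only [if_neg h, if_neg (fun h' : (d : ZMod m) = u ∧ _ => h h'.2)]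
      simp
  have h1 : ‖(m.totient : ℂ) * (S : ℂ)‖ ≤ 2 ^ s.card * ∑ χ, b χ := by
    rw [hkey, Finset.mul_sum]
    refine (norm_sum_le _ _).trans (Finset.sum_le_sum fun χ _ => ?_)
    rw [norm_mul]
    calc _ ≤ 1 * (2 ^ s.card * b χ) := by
          gcongr
          · exact χ.norm_le_one _
          · exact norm_siftedMoebiusSum_le (by intro a c; push_cast; rw [map_mul])
              (fun a => χ.norm_le_one _) (hb χ) s hs x
      _ = _ := one_mul _
  rw [norm_mul, Complex.norm_natCast, Complex.norm_real, Real.norm_eq_abs] at h1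
  have h2 : (0 : ℝ) ≤ 2 ^ s.card := by positivity
  nlinarith [abs_nonneg S]

/-! ### Divisor sums of fractional parts -/

open ArithmeticFunction in
theorem sum_divisors_moebius (n : ℕ) : ∑ d ∈ n.divisors, moebius d = if n = 1 then 1 else 0 := by
  rw [← coe_mul_zeta_apply, moebius_mul_coe_zeta, one_apply]

theorem sum_Ioc_sum_divisors {M : Type*} [AddCommMonoid M] (F : ℕ → ℕ → M) (N : ℕ) :
    ∑ n ∈ Finset.Ioc 0 N, ∑ d ∈ n.divisors, F d (n / d) =
      ∑ d ∈ Finset.Ioc 0 N, ∑ e ∈ Finset.Ioc 0 (N / d), F d e := by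
  rw [Finset.sum_sigma', Finset.sum_sigma']
  refine Finset.sum_bij' (fun x _ => ⟨x.2, x.1 / x.2⟩) (fun x _ => ⟨x.1 * x.2, x.1⟩) ?_ ?_ ?_ ?_ ?_
  · rintro ⟨n, d⟩ h
    simp only [Finset.mem_sigma, Finset.mem_Ioc, Nat.mem_divisors] at h ⊢
    obtain ⟨⟨h1, h2⟩, h3, h4⟩ := h
    have hd := Nat.pos_of_dvd_of_pos h3 h1
    exact ⟨⟨hd, (Nat.le_of_dvd h1 h3).trans h2⟩, Nat.div_pos (Nat.le_of_dvd h1 h3) hd,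
      Nat.div_le_div_right h2⟩
  · rintro ⟨d, e⟩ h
    simp only [Finset.mem_sigma, Finset.mem_Ioc, Nat.mem_divisors] at h ⊢
    obtain ⟨⟨h1, h2⟩, h3, h4⟩ := h
    refine ⟨⟨Nat.mul_pos h1 h3, ?_⟩, dvd_mul_right _ _, (Nat.mul_pos h1 h3).ne'⟩
    rw [mul_comm]; exact (Nat.le_div_iff_mul_le h1).1 h4
  · rintro ⟨n, d⟩ h
    simp only [Finset.mem_sigma, Finset.mem_Ioc, Nat.mem_divisors] at h
    simp only [Nat.mul_div_cancel' h.2.1]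
  · rintro ⟨d, e⟩ h
    simp only [Finset.mem_sigma, Finset.mem_Ioc] at h
    simp only [Nat.mul_div_cancel_left _ h.1.1]
  · rintro ⟨n, d⟩ _
    rfl

theorem sum_Ioc_ite_natCast_eq {M : Type*} [AddCommMonoid M] {m c : ℕ} (hc : 1 ≤ c) (hcm : c ≤ m)
    (h : ℕ → M) (z : ℕ) :
    ∑ e ∈ Finset.Ioc 0 z, (if (e : ZMod m) = c then h e else 0) =
      ∑ t ∈ Finset.range ((z + m - c) / m), h (c + m * t) := by
  have hm : 0 < m := hc.trans hcm
  rw [← Finset.sum_filter]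
  symm
  refine Finset.sum_bij (fun t _ => c + m * t) ?_ ?_ ?_ (fun _ _ => rfl)
  · intro t ht
    rw [Finset.mem_range, Nat.lt_iff_add_one_le, Nat.le_div_iff_mul_le hm] at ht
    rw [Finset.mem_filter, Finset.mem_Ioc]
    refine ⟨⟨by omega, ?_⟩, by simp⟩
    have : (t + 1) * m = m * t + m := by ring
    omega
  · intro a _ b _ hab
    have : m * a = m * b := by omega
    exact Nat.eq_of_mul_eq_mul_left hm this
  · intro e he
    rw [Finset.mem_filter, Finset.mem_Ioc, ZMod.natCast_eq_natCast_iff] at he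
    obtain ⟨⟨he0, hez⟩, hmod⟩ := he
    have hce : c ≤ e := by
      by_contra! hlt
      have h2 := (Nat.modEq_iff_dvd' hlt.le).1 hmod
      have := Nat.le_of_dvd (by omega) h2
      omega
    obtain ⟨t, ht⟩ := (Nat.modEq_iff_dvd' hce).1 hmod.symm
    refine ⟨t, ?_, by omega⟩
    rw [Finset.mem_range, Nat.lt_iff_add_one_le, Nat.le_div_iff_mul_le hm]
    have : (t + 1) * m = m * t + m := by ring
    omega

/-- The representative is taken in `[1, m]` so that the positive members of the class are exactly `c
+ m * t` with `t ≥ 0`. -/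
theorem exists_natCast_eq_mem_Icc {m : ℕ} [NeZero m] (v : ZMod m) :
    ∃ c : ℕ, 1 ≤ c ∧ c ≤ m ∧ (c : ZMod m) = v := by
  have h1 := NeZero.pos m
  by_cases h : v.val = 0
  · exact ⟨m, h1, le_rfl, by rw [(ZMod.val_eq_zero v).1 h]; simp⟩
  · exact ⟨v.val, by omega, (ZMod.val_lt v).le, ZMod.natCast_zmod_val v⟩

/-- Along `e = c + m t` the fractional parts are a sawtooth sum plus half the number of terms. That
number is `Y / (d m)` up to 2, so its main part is again controlled by `∑ f d / d`; the three
contributions are `286 B Y`, `B Y` and `Y`. -/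
theorem abs_sum_mul_sum_fract_le {β : ℝ} (hβ : Irrational β) {m : ℕ} [NeZero m] {f : ℕ → ℝ} {B : ℝ}
    (hf : ∀ d, |f d| ≤ 1) (hB : ∀ n, |∑ d ∈ Finset.Ioc 0 n, f d / d| ≤ B) (hB1 : 1 ≤ B)
    (v : ZMod m) (Y : ℕ) :
    |∑ d ∈ Finset.Ioc 0 Y, f d * ∑ e ∈ Finset.Ioc 0 (Y / d),
      (if (e : ZMod m) = v then Int.fract (β * e) else 0)| ≤ 288 * B * Y := by
  obtain ⟨c, hc, hcm, rfl⟩ := exists_natCast_eq_mem_Icc v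
  have hm : 0 < m := hc.trans hcm
  have hm0 : (0 : ℝ) < m := by exact_mod_cast hm
  have hm1 : (1 : ℝ) ≤ m := by exact_mod_cast hm
  set ν : ℕ → ℕ := fun d => (Y / d + m - c) / m with hν
  have hinner : ∀ d ∈ Finset.Ioc 0 Y, f d * ∑ e ∈ Finset.Ioc 0 (Y / d),
      (if (e : ZMod m) = c then Int.fract (β * e) else 0) =
      f d * sawSum (β * m) (β * c) (ν d) + (Y / m / 2 * (f d / d) +
        f d * ((ν d - Y / (d * m)) / 2)) := fun d hd => by
    have hd0 : (d : ℝ) ≠ 0 := by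
      rw [Finset.mem_Ioc] at hd; exact_mod_cast (by omega : d ≠ 0)
    rw [sum_Ioc_ite_natCast_eq hc hcm]
    have : ∑ t ∈ Finset.range (ν d), Int.fract (β * ((c + m * t : ℕ) : ℝ)) =
        sawSum (β * m) (β * c) (ν d) + ν d / 2 := by
      rw [sawSum, Finset.sum_sub_distrib, Finset.sum_const, Finset.card_range, nsmul_eq_mul,
        mul_one_div, sub_add_cancel]
      refine Finset.sum_congr rfl fun t _ => ?_
      push_cast
      ring_nf
    rw [this]
    field_simp
    ring
  rw [Finset.sum_congr rfl hinner, Finset.sum_add_distrib, Finset.sum_add_distrib, ← Finset.mul_sum]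
  have t1 := abs_sum_mul_sawSum_le (hβ.mul_natCast hm.ne') hf hB hB1 hc hcm Y (β * c)
  have t2 : |(Y : ℝ) / m / 2 * ∑ d ∈ Finset.Ioc 0 Y, f d / d| ≤ B * Y := by
    rw [abs_mul, abs_of_nonneg (by positivity)]
    calc (Y : ℝ) / m / 2 * |∑ d ∈ Finset.Ioc 0 Y, f d / d| ≤ Y / 1 / 1 * B := by
          gcongr
          · norm_num
          · exact hB Y
      _ = B * Y := by ring
  have t3 : |∑ d ∈ Finset.Ioc 0 Y, f d * ((ν d - Y / (d * m)) / 2)| ≤ Y := by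
    refine (Finset.abs_sum_le_sum_abs _ _).trans ((Finset.sum_le_card_nsmul _ _ 1 fun d hd => ?_).trans
      (by simp))
    rw [Finset.mem_Ioc] at hd
    have hd0 : (0 : ℝ) < d := by exact_mod_cast hd.1
    have hcm' : (c : ℝ) ≤ m := by exact_mod_cast hcm
    have hc0 : (0 : ℝ) ≤ c := by positivity
    have a1 : ((Y / d : ℕ) : ℝ) ≤ Y / d := Nat.cast_div_le
    have a2 : (Y : ℝ) / d < (Y / d : ℕ) + 1 := by
      rw [div_lt_iff₀ hd0]; exact_mod_cast Nat.lt_mul_of_div_lt (Nat.lt_succ_self (Y / d)) hd.1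
    have a3 : ((Y / d + m - c : ℕ) : ℝ) = (Y / d : ℕ) + m - c := by
      rw [Nat.cast_sub (hcm.trans (Nat.le_add_left _ _))]; push_cast; ring
    have b1 : (ν d : ℝ) ≤ (Y / d + m - c : ℕ) / m := Nat.cast_div_le
    have b2 : ((Y / d + m - c : ℕ) : ℝ) / m < ν d + 1 := by
      rw [div_lt_iff₀ hm0]
      exact_mod_cast Nat.lt_mul_of_div_lt (Nat.lt_succ_self ((Y / d + m - c) / m)) hm
    rw [a3] at b1 b2
    rw [le_div_iff₀ hm0] at b1
    rw [div_lt_iff₀ hm0] at b2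
    have b3 : |(ν d : ℝ) - Y / (d * m)| ≤ 2 := by
      rw [← div_div, abs_le]
      constructor
      · rw [neg_le_sub_iff_le_add, div_le_iff₀ hm0]; nlinarith
      · rw [sub_le_iff_le_add, add_comm, ← sub_le_iff_le_add, le_div_iff₀ hm0]; nlinarith
    rw [abs_mul, abs_div, abs_two]
    exact mul_le_one₀ (hf d) (by positivity) (by linarith)
  have hY : (0 : ℝ) ≤ Y := by positivity
  refine (abs_add_le _ _).trans ?_
  have := (abs_add_le ((Y : ℝ) / m / 2 * ∑ d ∈ Finset.Ioc 0 Y, f d / d)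
    (∑ d ∈ Finset.Ioc 0 Y, f d * ((ν d - Y / (d * m)) / 2)))
  nlinarith

/-- As `v` is a unit, every divisor `d` of `n` is a unit mod `m`. Sorting by its class `u` fixes the
class of `n / d`, and at most `m` classes occur. -/
theorem exists_bound_sum_divisors_fract (m : ℕ) [NeZero m] :
    ∃ C : ℝ, 0 < C ∧ ∀ β : ℝ, Irrational β → ∀ v : ZMod m, IsUnit v → ∀ l : ℕ, 1 ≤ l → ∀ Y : ℕ,
      |∑ n ∈ Finset.Ioc 0 Y, if (n : ZMod m) = v then ∑ d ∈ n.divisors,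
        (if d.Coprime l then (ArithmeticFunction.moebius d : ℝ) else 0) *
          Int.fract (β * (n / d : ℕ)) else 0| ≤ C * 2 ^ l.primeFactors.card * Y := by
  obtain ⟨B, hB1, hB⟩ := exists_bound_moebius_progression m
  have hm : (0 : ℝ) < m := by exact_mod_cast NeZero.pos m
  refine ⟨m * (288 * B), by positivity, fun β hβ v hv l hl Y => ?_⟩
  set f : ZMod m → ℕ → ℝ := fun u d => if (d : ZMod m) = u ∧ ∀ p ∈ l.primeFactors, ¬ p ∣ d then
    (ArithmeticFunction.moebius d : ℝ) else 0 with hf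
  have hf1 : ∀ u d, |f u d| ≤ 1 := fun u d => by
    simp only [hf]
    split_ifs
    · exact_mod_cast ArithmeticFunction.abs_moebius_le_one
    · simp
  have hcop : ∀ d : ℕ, d.Coprime l ↔ ∀ p ∈ l.primeFactors, ¬ p ∣ d := fun d => by
    constructor
    · intro h p hp hpd
      exact Nat.not_coprime_of_dvd_of_dvd (Nat.prime_of_mem_primeFactors hp).one_lt hpd
        (Nat.dvd_of_mem_primeFactors hp) h
    · intro h
      refine Nat.coprime_of_dvd fun p hp hpd hpl => ?_
      exact h p (Nat.mem_primeFactors.2 ⟨hp, hpl, by omega⟩) hpd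
  have hsum : ∑ n ∈ Finset.Ioc 0 Y, (if (n : ZMod m) = v then ∑ d ∈ n.divisors,
        (if d.Coprime l then (ArithmeticFunction.moebius d : ℝ) else 0) *
          Int.fract (β * (n / d : ℕ)) else 0) =
      ∑ u : (ZMod m)ˣ, ∑ d ∈ Finset.Ioc 0 Y, f u d * ∑ e ∈ Finset.Ioc 0 (Y / d),
        (if (e : ZMod m) = (u⁻¹ : (ZMod m)ˣ) * v then Int.fract (β * e) else 0) := by
    have e1 : ∀ n ∈ Finset.Ioc 0 Y, (if (n : ZMod m) = v then ∑ d ∈ n.divisors,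
        (if d.Coprime l then (ArithmeticFunction.moebius d : ℝ) else 0) *
          Int.fract (β * (n / d : ℕ)) else 0) = ∑ d ∈ n.divisors,
        (if (d : ZMod m) * ((n / d : ℕ) : ZMod m) = v then
          (if d.Coprime l then (ArithmeticFunction.moebius d : ℝ) else 0) *
          Int.fract (β * (n / d : ℕ)) else 0) := fun n _ => by
      have : ∀ d ∈ n.divisors, (d : ZMod m) * ((n / d : ℕ) : ZMod m) = n := fun d hd => by
        rw [← Nat.cast_mul, Nat.mul_div_cancel' (Nat.dvd_of_mem_divisors hd)]
      split_ifs with h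
      · refine Finset.sum_congr rfl fun d hd => ?_
        rw [this d hd, if_pos h]
      · symm
        refine Finset.sum_eq_zero fun d hd => ?_
        rw [this d hd, if_neg h]
    rw [Finset.sum_congr rfl e1, sum_Ioc_sum_divisors (fun d e =>
      if (d : ZMod m) * (e : ZMod m) = v then
          (if d.Coprime l then (ArithmeticFunction.moebius d : ℝ) else 0) *
          Int.fract (β * e) else 0), Finset.sum_comm]
    refine Finset.sum_congr rfl fun d _ => ?_
    simp only [Finset.mul_sum]
    rw [Finset.sum_comm]
    refine Finset.sum_congr rfl fun e _ => ?_
    by_cases hd : IsUnit (d : ZMod m)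
    · obtain ⟨w, hw⟩ := hd
      rw [Finset.sum_eq_single w]
      · have : (d : ZMod m) * e = v ↔ (e : ZMod m) = (w⁻¹ : (ZMod m)ˣ) * v := by
          rw [← hw, Units.eq_inv_mul_iff_mul_eq]
        simp only [this, hf, hw, hcop, true_and]
        split_ifs <;> simp
      · intro u _ hu
        have : ¬ ((d : ZMod m) = u) := fun h => hu (Units.ext (by rw [← h, hw]))
        simp only [hf, this, false_and, if_false, zero_mul]
      · intro h; exact absurd (Finset.mem_univ _) h
    · rw [if_neg, eq_comm]
      · refine Finset.sum_eq_zero fun u _ => ?_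
        have : ¬ ((d : ZMod m) = u) := fun h => hd (h ▸ u.isUnit)
        simp only [hf, this, false_and, if_false, zero_mul]
      · intro h
        exact hd (isUnit_of_mul_isUnit_left (h ▸ hv))
  rw [hsum]
  have h2 : (1 : ℝ) ≤ 2 ^ l.primeFactors.card := one_le_pow₀ (by norm_num)
  refine (Finset.abs_sum_le_sum_abs _ _).trans ((Finset.sum_le_card_nsmul _ _
    (288 * (2 ^ l.primeFactors.card * B) * Y) fun u _ => ?_).trans ?_)
  · exact abs_sum_mul_sum_fract_le hβ (hf1 u)
      (fun x => hB u u.isUnit _ (fun p hp => Nat.prime_of_mem_primeFactors hp) x)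
      (by nlinarith) _ Y
  · have hcard : ((Finset.univ : Finset (ZMod m)ˣ).card : ℝ) ≤ m := by
      rw [Finset.card_univ, ZMod.card_units_eq_totient]
      exact_mod_cast Nat.totient_le m
    rw [nsmul_eq_mul]
    calc _ ≤ (m : ℝ) * (288 * (2 ^ l.primeFactors.card * B) * Y) := by gcongr
      _ = _ := by ring

/-! ### Counting the fractions by Möbius inversion -/

/-- The number of positive integers up to `N` that are coprime to `n`. -/
def coprimeCount (n N : ℕ) : ℕ := ((Finset.Ioc 0 N).filter (·.Coprime n)).card

theorem sum_filter_dvd_moebius {l a : ℕ} (hl : l ≠ 0) :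
    ∑ d ∈ l.divisors, (if d ∣ a then ArithmeticFunction.moebius d else 0) =
      if a.Coprime l then 1 else 0 := by
  rw [← Finset.sum_filter]
  have : l.divisors.filter (· ∣ a) = (a.gcd l).divisors := by
    ext d
    simp only [Finset.mem_filter, Nat.mem_divisors, Nat.dvd_gcd_iff]
    refine ⟨fun h => ⟨⟨h.2, h.1.1⟩, Nat.gcd_ne_zero_right hl⟩, fun h => ⟨⟨h.1.2, hl⟩, h.1.1⟩⟩
  rw [this, sum_divisors_moebius]

/-- Once `a` is coprime to `l`, its divisors `e` are too, so only such `e` need be summed. Then `d`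
and `e` are coprime and their divisibility conditions merge into one, which separates the dependence
on `l` from that on `r`. -/
theorem coprimeCount_pow_mul {k l r : ℕ} (hk : k ≠ 0) (hl : l ≠ 0) (hr : r ≠ 0) (N : ℕ) :
    (coprimeCount (l ^ k * r) N : ℤ) = ∑ d ∈ l.divisors, ∑ e ∈ r.divisors,
      ArithmeticFunction.moebius d * (if e.Coprime l then ArithmeticFunction.moebius e else 0) *
        (N / (d * e) : ℕ) := by
  have hcount : ∀ d e : ℕ, ((N / (d * e) : ℕ) : ℤ) =
      ∑ a ∈ Finset.Ioc 0 N, if d * e ∣ a then 1 else 0 := fun d e => by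
    rw [← Nat.Ioc_filter_dvd_card_eq_div, Finset.card_filter]; push_cast; rfl
  have hswap : ∑ d ∈ l.divisors, ∑ e ∈ r.divisors,
      ArithmeticFunction.moebius d * (if e.Coprime l then ArithmeticFunction.moebius e else 0) *
        (N / (d * e) : ℕ) = ∑ a ∈ Finset.Ioc 0 N, ∑ d ∈ l.divisors, ∑ e ∈ r.divisors,
      ArithmeticFunction.moebius d * (if e.Coprime l then ArithmeticFunction.moebius e else 0) *
        (if d * e ∣ a then 1 else 0) := by
    simp only [hcount, Finset.mul_sum]
    rw [Finset.sum_comm]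
    rw [Finset.sum_congr rfl fun e _ => Finset.sum_comm]
    rw [Finset.sum_comm]
    refine Finset.sum_congr rfl fun a _ => ?_
    rw [Finset.sum_comm]
  rw [hswap, coprimeCount, Finset.card_filter]
  push_cast
  refine Finset.sum_congr rfl fun a _ => ?_
  have hprod : ∑ d ∈ l.divisors, ∑ e ∈ r.divisors,
      ArithmeticFunction.moebius d * (if e.Coprime l then ArithmeticFunction.moebius e else 0) *
        (if d * e ∣ a then 1 else 0) =
      (∑ d ∈ l.divisors, if d ∣ a then ArithmeticFunction.moebius d else 0) *
      ∑ e ∈ r.divisors, if e ∣ a then (if e.Coprime l then ArithmeticFunction.moebius e else 0)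
        else 0 := by
    rw [Finset.sum_mul_sum]
    refine Finset.sum_congr rfl fun d hd => Finset.sum_congr rfl fun e _ => ?_
    by_cases hel : e.Coprime l
    · have hde : d.Coprime e := (hel.coprime_dvd_right (Nat.dvd_of_mem_divisors hd)).symm
      have : d * e ∣ a ↔ d ∣ a ∧ e ∣ a :=
        ⟨fun h => ⟨dvd_of_mul_right_dvd h, dvd_of_mul_left_dvd h⟩,
          fun h => hde.mul_dvd_of_dvd_of_dvd h.1 h.2⟩
      by_cases h1 : d ∣ a <;> by_cases h2 : e ∣ a <;> simp [this, h1, h2]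
    · simp [hel]
  rw [hprod, sum_filter_dvd_moebius hl]
  by_cases hal : a.Coprime l
  · have h2 : ∑ e ∈ r.divisors, (if e ∣ a then
        (if e.Coprime l then ArithmeticFunction.moebius e else 0) else 0) =
        ∑ e ∈ r.divisors, (if e ∣ a then ArithmeticFunction.moebius e else 0) := by
      refine Finset.sum_congr rfl fun e _ => ?_
      by_cases h : e ∣ a
      · rw [if_pos h, if_pos h, if_pos (hal.coprime_dvd_left h)]
      · rw [if_neg h, if_neg h]
    rw [h2, sum_filter_dvd_moebius hr, if_pos hal, one_mul]
    have : a.Coprime (l ^ k * r) ↔ a.Coprime r := by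
      rw [Nat.coprime_mul_iff_right, Nat.coprime_pow_right_iff (Nat.pos_of_ne_zero hk)]
      exact ⟨fun h => h.2, fun h => ⟨hal, h⟩⟩
    simp only [this]
  · have : ¬ a.Coprime (l ^ k * r) := fun h => hal
      ((Nat.coprime_pow_right_iff (Nat.pos_of_ne_zero hk) _ _).1 (Nat.coprime_mul_iff_right.1 h).1)
    rw [if_neg hal, if_neg this, zero_mul]

/-- At `N = l ^ k * r` the quotients by `d * e` are exact, so the main terms cancel and only the
fractional parts lost in the floors survive. -/
theorem coprimeCount_sub_eq {k l r : ℕ} (hk : k ≠ 0) (hl : l ≠ 0) (hr : r ≠ 0) {α : ℝ}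
    (hα : 0 ≤ α) :
    (coprimeCount (l ^ k * r) ⌊α * (l ^ k * r : ℕ)⌋₊ : ℝ) -
      α * coprimeCount (l ^ k * r) (l ^ k * r) =
    -∑ d ∈ l.divisors, (ArithmeticFunction.moebius d : ℝ) * ∑ e ∈ r.divisors,
      (if e.Coprime l then (ArithmeticFunction.moebius e : ℝ) else 0) *
        Int.fract (α * (l ^ k / d : ℕ) * (r / e : ℕ)) := by
  have hcast : ∀ N : ℕ, (coprimeCount (l ^ k * r) N : ℝ) =
      ∑ d ∈ l.divisors, ∑ e ∈ r.divisors, (ArithmeticFunction.moebius d : ℝ) *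
        (if e.Coprime l then (ArithmeticFunction.moebius e : ℝ) else 0) * (N / (d * e) : ℕ) :=
    fun N => by
      have := congrArg (Int.cast : ℤ → ℝ) (coprimeCount_pow_mul hk hl hr N)
      simpa only [Int.cast_sum, Int.cast_mul, Int.cast_natCast, Int.cast_ite, Int.cast_zero]
        using this
  rw [hcast, hcast, Finset.mul_sum, ← Finset.sum_sub_distrib, ← Finset.sum_neg_distrib]
  refine Finset.sum_congr rfl fun d hd => ?_
  rw [Finset.mul_sum, Finset.mul_sum, ← Finset.sum_sub_distrib, ← Finset.sum_neg_distrib]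
  refine Finset.sum_congr rfl fun e he => ?_
  have hdl : d ∣ l ^ k := dvd_pow (Nat.dvd_of_mem_divisors hd) hk
  have her := Nat.dvd_of_mem_divisors he
  have hd0 : (d : ℝ) ≠ 0 := by exact_mod_cast (Nat.pos_of_mem_divisors hd).ne'
  have he0 : (e : ℝ) ≠ 0 := by exact_mod_cast (Nat.pos_of_mem_divisors he).ne'
  have h1 : (l ^ k * r) / (d * e) = (l ^ k / d) * (r / e) := Nat.mul_div_mul_comm hdl her
  have h2 : ((⌊α * (l ^ k * r : ℕ)⌋₊ / (d * e) : ℕ) : ℝ) =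
      α * (l ^ k / d : ℕ) * (r / e : ℕ) - Int.fract (α * (l ^ k / d : ℕ) * (r / e : ℕ)) := by
    have h3 : α * (l ^ k * r : ℕ) / (d * e : ℕ) = α * (l ^ k / d : ℕ) * (r / e : ℕ) := by
      rw [Nat.cast_div hdl hd0, Nat.cast_div her he0]
      push_cast
      field_simp
    rw [← Nat.floor_div_natCast, h3, Int.self_sub_fract]
    exact natCast_floor_eq_intCast_floor (by positivity)
  rw [h1, h2]
  push_cast
  ring

theorem kFree_iff_floorRoot_eq_one {k : ℕ} (hk : k ≠ 0) (n : ℕ) :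
    KFree k n ↔ Nat.floorRoot k n = 1 := by
  constructor
  · intro h
    by_contra hne
    obtain ⟨p, hp, hpd⟩ := Nat.exists_prime_and_dvd hne
    have h1 := Nat.pow_dvd_iff_dvd_floorRoot.2 hpd
    exact h p hp ((dvd_pow_self p hk).trans h1) h1
  · intro h p hp _ h1
    have h2 := Nat.pow_dvd_iff_dvd_floorRoot.1 h1
    rw [h] at h2
    exact hp.one_lt.ne' (Nat.dvd_one.1 h2)

-- The `l` with `l ^ k ∣ n` are the divisors of `Nat.floorRoot k n`, which is 1 exactly for `k`-free
-- `n`.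
open Classical in
theorem ite_kFree_eq_sum_moebius {k n Q : ℕ} (hk : k ≠ 0) (hn : 0 < n) (hnQ : n ≤ Q) :
    (if KFree k n then (1 : ℤ) else 0) =
      ∑ l ∈ Finset.Ioc 0 Q, if l ^ k ∣ n then ArithmeticFunction.moebius l else 0 := by
  rw [if_congr (kFree_iff_floorRoot_eq_one hk n) rfl rfl, ← sum_divisors_moebius, ← Finset.sum_filter]
  refine Finset.sum_congr ?_ fun _ _ => rfl
  ext l
  rw [Finset.mem_filter, Finset.mem_Ioc, Nat.mem_divisors, Nat.pow_dvd_iff_dvd_floorRoot]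
  have h0 : Nat.floorRoot k n ≠ 0 := Nat.floorRoot_ne_zero.2 ⟨hk, hn.ne'⟩
  refine ⟨fun h => ⟨⟨Nat.pos_of_dvd_of_pos h.1 (Nat.pos_of_ne_zero h0), ?_⟩, h.1⟩,
    fun h => ⟨h.2, h0⟩⟩
  have h1 := Nat.pow_dvd_iff_dvd_floorRoot.2 h.1
  exact (Nat.le_of_dvd hn ((dvd_pow_self l hk).trans h1)).trans hnQ

open Classical in
theorem countLE_farey (Q k m : ℕ) (b : ℤ) {α : ℝ} (h0 : 0 ≤ α) (h1 : α ≤ 1) :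
    countLE (farey Q k m b) α =
      ∑ q ∈ (Finset.Ioc 0 Q).filter (fun q => KFree k q ∧ (q : ℤ) ≡ b [ZMOD (m : ℤ)]),
        coprimeCount q ⌊α * q⌋₊ := by
  simp only [coprimeCount]
  rw [← Finset.card_sigma, countLE]
  symm
  refine Finset.card_bij (fun x _ => (x.2 : ℝ) / (x.1 : ℝ)) ?_ ?_ ?_
  · rintro ⟨q, a⟩ h
    simp only [Finset.mem_sigma, Finset.mem_filter, Finset.mem_Ioc] at h ⊢
    obtain ⟨⟨⟨hq0, hqQ⟩, hkf, hmod⟩, ⟨ha0, ha⟩, hcop⟩ := h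
    have hq : (0 : ℝ) < q := by exact_mod_cast hq0
    have ha' : (a : ℝ) ≤ α * q := (Nat.le_floor_iff (by positivity)).1 ha
    refine ⟨mem_farey.2 ⟨a, q, ha0, ?_, hqQ, hcop, hkf, hmod, rfl⟩, (div_le_iff₀ hq).2 ha'⟩
    have : (a : ℝ) ≤ q := by nlinarith
    exact_mod_cast this
  · rintro ⟨q, a⟩ h ⟨q', a'⟩ h' heq
    simp only [Finset.mem_sigma, Finset.mem_filter, Finset.mem_Ioc] at h h' heq
    have hq : (q : ℝ) ≠ 0 := by exact_mod_cast (by omega : q ≠ 0)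
    have hq' : (q' : ℝ) ≠ 0 := by exact_mod_cast (by omega : q' ≠ 0)
    rw [div_eq_div_iff hq hq'] at heq
    have heq' : a * q' = a' * q := by exact_mod_cast heq
    have hc : a.Coprime q := h.2.2
    have hc' : a'.Coprime q' := h'.2.2
    have d1 : a ∣ a' := hc.dvd_of_dvd_mul_right ⟨q', heq'.symm⟩
    have d2 : a' ∣ a := hc'.dvd_of_dvd_mul_right ⟨q, heq'⟩
    have haa := Nat.dvd_antisymm d1 d2
    subst haa
    have := Nat.eq_of_mul_eq_mul_left h.2.1.1 heq'
    subst this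
    rfl
  · intro x hx
    rw [Finset.mem_filter, mem_farey] at hx
    obtain ⟨⟨a, q, ha, haq, hqQ, hcop, hkf, hmod, rfl⟩, hle⟩ := hx
    have hq0 : 0 < q := by omega
    have hq : (0 : ℝ) < q := by exact_mod_cast hq0
    refine ⟨⟨q, a⟩, ?_, rfl⟩
    simp only [Finset.mem_sigma, Finset.mem_filter, Finset.mem_Ioc]
    exact ⟨⟨⟨hq0, hqQ⟩, hkf, hmod⟩, ⟨ha, (Nat.le_floor_iff (by positivity)).2
      ((div_le_iff₀ hq).1 hle)⟩, hcop⟩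

theorem one_div_le_and_le_one_of_mem_farey {Q k m : ℕ} {b : ℤ} {x : ℝ} (hx : x ∈ farey Q k m b) :
    1 / (Q : ℝ) ≤ x ∧ x ≤ 1 := by
  obtain ⟨a, q, ha, haq, hqQ, -, -, -, rfl⟩ := mem_farey.1 hx
  have hq : (0 : ℝ) < q := by exact_mod_cast (by omega : 0 < q)
  have ha' : (1 : ℝ) ≤ a := by exact_mod_cast ha
  have hqQ' : (q : ℝ) ≤ Q := by exact_mod_cast hqQ
  constructor
  · exact div_le_div₀ (by linarith) ha' hq hqQ'
  · rw [div_le_one hq]; exact_mod_cast haq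

theorem countLE_farey_one (Q k m : ℕ) (b : ℤ) :
    countLE (farey Q k m b) 1 = (farey Q k m b).card := by
  rw [countLE, Finset.filter_true_of_mem fun x hx => (one_div_le_and_le_one_of_mem_farey hx).2]

open Classical in
theorem card_farey (Q k m : ℕ) (b : ℤ) :
    (farey Q k m b).card =
      ∑ q ∈ (Finset.Ioc 0 Q).filter (fun q => KFree k q ∧ (q : ℤ) ≡ b [ZMOD (m : ℤ)]),
        coprimeCount q q := by
  rw [← countLE_farey_one, countLE_farey Q k m b zero_le_one le_rfl]
  simp

/-! ### Divisor-function sums and the uniform counting error -/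

theorem sum_Ioc_one_div_sq_le (Q : ℕ) : ∑ a ∈ Finset.Ioc 0 Q, (1 : ℝ) / a ^ 2 ≤ 2 := by
  have h : ∀ n : ℕ, ∑ a ∈ Finset.Ioc 0 (n + 1), (1 : ℝ) / a ^ 2 ≤ 2 - 1 / (n + 1 : ℕ) := by
    intro n
    induction n with
    | zero => norm_num
    | succ n ih =>
      rw [Finset.sum_Ioc_succ_top (by omega)]
      have : (1 : ℝ) / ((n + 1 + 1 : ℕ) : ℝ) ^ 2 ≤ 1 / (n + 1 : ℕ) - 1 / (n + 1 + 1 : ℕ) := by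
        push_cast
        rw [div_sub_div _ _ (by positivity) (by positivity), div_le_div_iff₀ (by positivity) (by positivity)]
        nlinarith [Nat.cast_nonneg (α := ℝ) n]
      linarith
  refine le_trans ?_ ((h Q).trans (by have : (0 : ℝ) ≤ 1 / (Q + 1 : ℕ) := by positivity
                                      linarith))
  exact Finset.sum_le_sum_of_subset_of_nonneg (Finset.Ioc_subset_Ioc_right (by omega))
    fun _ _ _ => by positivity

/-- Each pair `(d, n / d)` contributes at least `g n` to the expanded square. Used twice, starting
from `∑ 1 / a² ≤ 2`, this yields 4 and then 16. -/
theorem sum_Ioc_divisors_mul_le {g : ℕ → ℝ} (hg0 : ∀ a, 0 ≤ g a)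
    (hg : ∀ a b, g (a * b) ≤ g a * g b) (Q : ℕ) :
    ∑ n ∈ Finset.Ioc 0 Q, n.divisors.card * g n ≤ (∑ a ∈ Finset.Ioc 0 Q, g a) ^ 2 := by
  calc ∑ n ∈ Finset.Ioc 0 Q, n.divisors.card * g n
      ≤ ∑ n ∈ Finset.Ioc 0 Q, ∑ d ∈ n.divisors, g d * g (n / d) := by
        refine Finset.sum_le_sum fun n _ => ?_
        rw [← nsmul_eq_mul]
        refine Finset.card_nsmul_le_sum _ _ _ fun d hd => ?_
        have := hg d (n / d)
        rwa [Nat.mul_div_cancel' (Nat.dvd_of_mem_divisors hd)] at this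
    _ = ∑ d ∈ Finset.Ioc 0 Q, ∑ e ∈ Finset.Ioc 0 (Q / d), g d * g e :=
        sum_Ioc_sum_divisors (fun d e => g d * g e) Q
    _ ≤ ∑ d ∈ Finset.Ioc 0 Q, ∑ e ∈ Finset.Ioc 0 Q, g d * g e := by
        refine Finset.sum_le_sum fun d _ => ?_
        exact Finset.sum_le_sum_of_subset_of_nonneg
          (Finset.Ioc_subset_Ioc_right (Nat.div_le_self _ _))
          fun e _ _ => mul_nonneg (hg0 _) (hg0 _)
    _ = _ := by rw [sq, Finset.sum_mul_sum]

open Pointwise in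
theorem card_divisors_mul_le (a b : ℕ) :
    (a * b).divisors.card ≤ a.divisors.card * b.divisors.card := by
  rw [Nat.divisors_mul]
  exact Finset.card_mul_le

theorem sum_card_divisors_sq_div_sq_le (Q : ℕ) :
    ∑ l ∈ Finset.Ioc 0 Q, (l.divisors.card : ℝ) ^ 2 / l ^ 2 ≤ 16 := by
  have h1 := sum_Ioc_divisors_mul_le (g := fun a => (1 : ℝ) / a ^ 2) (fun a => by positivity)
    (fun a b => le_of_eq (by push_cast; field_simp)) Q
  have h2 := sum_Ioc_divisors_mul_le (g := fun a => (a.divisors.card : ℝ) * (1 / a ^ 2))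
    (fun a => by positivity) (fun a b => by
      have : ((a * b).divisors.card : ℝ) ≤ a.divisors.card * b.divisors.card := by
        exact_mod_cast card_divisors_mul_le a b
      calc ((a * b).divisors.card : ℝ) * (1 / ((a * b : ℕ) : ℝ) ^ 2)
          ≤ (a.divisors.card * b.divisors.card) * (1 / ((a * b : ℕ) : ℝ) ^ 2) := by gcongr
        _ = _ := by push_cast; field_simp) Q
  have h3 := sum_Ioc_one_div_sq_le Q
  have h4 : (0 : ℝ) ≤ ∑ a ∈ Finset.Ioc 0 Q, (1 : ℝ) / a ^ 2 :=
    Finset.sum_nonneg fun _ _ => by positivity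
  have h5 : (0 : ℝ) ≤ ∑ a ∈ Finset.Ioc 0 Q, (a.divisors.card : ℝ) * (1 / a ^ 2) :=
    Finset.sum_nonneg fun _ _ => by positivity
  have h6 : ∑ a ∈ Finset.Ioc 0 Q, (a.divisors.card : ℝ) * (1 / a ^ 2) ≤ 4 := by nlinarith
  calc _ = ∑ n ∈ Finset.Ioc 0 Q, (n.divisors.card : ℝ) * (n.divisors.card * (1 / n ^ 2)) :=
        Finset.sum_congr rfl fun n _ => by ring
    _ ≤ 16 := h2.trans (by nlinarith)

theorem two_pow_card_primeFactors_le {l : ℕ} (hl : l ≠ 0) :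
    2 ^ l.primeFactors.card ≤ l.divisors.card := by
  rw [Nat.card_divisors hl]
  refine Finset.pow_card_le_prod _ _ _ fun p hp => ?_
  have := (Nat.prime_of_mem_primeFactors hp).factorization_pos_of_dvd hl
    (Nat.dvd_of_mem_primeFactors hp)
  omega

theorem isUnit_intCast_of_gcd_eq_one {m : ℕ} {b : ℤ} (hb : Int.gcd b m = 1) :
    IsUnit (b : ZMod m) := by
  have h := (Int.isCoprime_iff_gcd_eq_one.2 hb).map (Int.castRingHom (ZMod m))
  simpa [isCoprime_zero_right] using h

theorem natCast_modEq_iff {m : ℕ} {b : ℤ} (q : ℕ) :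
    (q : ℤ) ≡ b [ZMOD (m : ℤ)] ↔ (q : ZMod m) = b := by
  rw [← ZMod.intCast_eq_intCast_iff]; simp

theorem natCast_mul_eq_iff {m : ℕ} {b : ZMod m} (w : (ZMod m)ˣ) {n : ℕ} (hn : (n : ZMod m) = w)
    (r : ℕ) : ((n * r : ℕ) : ZMod m) = b ↔ (r : ZMod m) = (w⁻¹ : (ZMod m)ˣ) * b := by
  rw [Nat.cast_mul, hn, Units.eq_inv_mul_iff_mul_eq]

/-- For each `l` there are `τ(l)` choices of `d`, each costing `C 2^ω(l) Q / l^k ≤ C τ(l) Q / l²`;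
summing over `l` gives the factor 16. If `l ^ k` is not a unit mod `m`, no multiple of it lies in
the class of `b`. -/
theorem exists_bound_countLE_farey (m : ℕ) [NeZero m] :
    ∃ C : ℝ, 0 < C ∧ ∀ k : ℕ, 2 ≤ k → ∀ b : ℤ, Int.gcd b m = 1 → ∀ Q : ℕ, ∀ α : ℝ,
      Irrational α → 0 ≤ α → α ≤ 1 →
      |(countLE (farey Q k m b) α : ℝ) - α * (farey Q k m b).card| ≤ C * Q := by
  classical
  obtain ⟨C, hC, hCb⟩ := exists_bound_sum_divisors_fract m
  refine ⟨C * 16, by positivity, fun k hk b hb Q α hα h0 h1 => ?_⟩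
  have hk0 : k ≠ 0 := by omega
  have hbu := isUnit_intCast_of_gcd_eq_one hb
  set err : ℕ → ℝ := fun q => (coprimeCount q ⌊α * q⌋₊ : ℝ) - α * coprimeCount q q with herr
  have hlhs : (countLE (farey Q k m b) α : ℝ) - α * (farey Q k m b).card =
      ∑ l ∈ Finset.Ioc 0 Q, (ArithmeticFunction.moebius l : ℝ) *
        ∑ r ∈ Finset.Ioc 0 (Q / l ^ k), if ((l ^ k * r : ℕ) : ZMod m) = b then err (l ^ k * r)
          else 0 := by
    have e1 : (countLE (farey Q k m b) α : ℝ) - α * (farey Q k m b).card =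
        ∑ q ∈ Finset.Ioc 0 Q, ∑ l ∈ Finset.Ioc 0 Q, (ArithmeticFunction.moebius l : ℝ) *
          (if l ^ k ∣ q then (if (q : ZMod m) = b then err q else 0) else 0) := by
      rw [countLE_farey Q k m b h0 h1, card_farey]
      push_cast
      rw [Finset.mul_sum, ← Finset.sum_sub_distrib, Finset.sum_filter]
      refine Finset.sum_congr rfl fun q hq => ?_
      rw [Finset.mem_Ioc] at hq
      have := congrArg (Int.cast : ℤ → ℝ) (ite_kFree_eq_sum_moebius hk0 hq.1 hq.2)
      simp only [Int.cast_ite, Int.cast_one, Int.cast_zero, Int.cast_sum] at this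
      have e2 : ∑ l ∈ Finset.Ioc 0 Q, (ArithmeticFunction.moebius l : ℝ) *
          (if l ^ k ∣ q then (if (q : ZMod m) = b then err q else 0) else 0) =
          (∑ l ∈ Finset.Ioc 0 Q, if l ^ k ∣ q then (ArithmeticFunction.moebius l : ℝ) else 0) *
          (if (q : ZMod m) = b then err q else 0) := by
        rw [Finset.sum_mul]
        refine Finset.sum_congr rfl fun l _ => ?_
        split_ifs <;> ring
      rw [e2, ← this]
      simp only [natCast_modEq_iff]
      by_cases h1 : KFree k q <;> by_cases h2 : (q : ZMod m) = b <;> simp [h1, h2, herr]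
    rw [e1, Finset.sum_comm]
    refine Finset.sum_congr rfl fun l hl => ?_
    rw [Finset.mem_Ioc] at hl
    have hlk : 0 < l ^ k := pow_pos hl.1 k
    rw [← Finset.mul_sum, ← Finset.sum_filter, filter_dvd_Ioc_eq_image hlk,
      Finset.sum_image fun a _ c _ h => Nat.eq_of_mul_eq_mul_left hlk h]
  have hl_bound : ∀ l ∈ Finset.Ioc 0 Q, |(ArithmeticFunction.moebius l : ℝ) *
        ∑ r ∈ Finset.Ioc 0 (Q / l ^ k), if ((l ^ k * r : ℕ) : ZMod m) = b then err (l ^ k * r)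
          else 0| ≤ C * Q * ((l.divisors.card : ℝ) ^ 2 / l ^ 2) := by
    intro l hl
    rw [Finset.mem_Ioc] at hl
    have hl0 : l ≠ 0 := by omega
    have hlk : 0 < l ^ k := pow_pos hl.1 k
    have hlr : (0 : ℝ) < l := by exact_mod_cast hl.1
    have hmu : |(ArithmeticFunction.moebius l : ℝ)| ≤ 1 := by
      exact_mod_cast ArithmeticFunction.abs_moebius_le_one
    suffices h : |∑ r ∈ Finset.Ioc 0 (Q / l ^ k), if ((l ^ k * r : ℕ) : ZMod m) = b then
        err (l ^ k * r) else 0| ≤ C * Q * ((l.divisors.card : ℝ) ^ 2 / l ^ 2) by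
      rw [abs_mul]
      exact (mul_le_of_le_one_left (abs_nonneg _) hmu).trans h
    by_cases hu : IsUnit ((l ^ k : ℕ) : ZMod m)
    · obtain ⟨w, hw⟩ := hu
      have hv : IsUnit (((w⁻¹ : (ZMod m)ˣ) : ZMod m) * b) := (w⁻¹).isUnit.mul hbu
      have e1 : (∑ r ∈ Finset.Ioc 0 (Q / l ^ k), if ((l ^ k * r : ℕ) : ZMod m) = b then
          err (l ^ k * r) else 0) = -∑ d ∈ l.divisors, (ArithmeticFunction.moebius d : ℝ) *
          ∑ r ∈ Finset.Ioc 0 (Q / l ^ k), if (r : ZMod m) = (w⁻¹ : (ZMod m)ˣ) * b then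
            ∑ e ∈ r.divisors, (if e.Coprime l then (ArithmeticFunction.moebius e : ℝ) else 0) *
              Int.fract (α * (l ^ k / d : ℕ) * (r / e : ℕ)) else 0 := by
        simp only [Finset.mul_sum _ _ (ArithmeticFunction.moebius _ : ℝ)]
        rw [Finset.sum_comm, ← Finset.sum_neg_distrib]
        refine Finset.sum_congr rfl fun r hr => ?_
        rw [Finset.mem_Ioc] at hr
        simp only [natCast_mul_eq_iff w hw.symm]
        split_ifs with h
        · simp only [herr]
          rw [coprimeCount_sub_eq hk0 hl0 (by omega) h0]
        · simp
      rw [e1, abs_neg]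
      have hd : ∀ d ∈ l.divisors, |(ArithmeticFunction.moebius d : ℝ) *
          ∑ r ∈ Finset.Ioc 0 (Q / l ^ k), if (r : ZMod m) = (w⁻¹ : (ZMod m)ˣ) * b then
            ∑ e ∈ r.divisors, (if e.Coprime l then (ArithmeticFunction.moebius e : ℝ) else 0) *
              Int.fract (α * (l ^ k / d : ℕ) * (r / e : ℕ)) else 0| ≤
          C * l.divisors.card * (Q / l ^ 2) := by
        intro d hd
        have hdl : d ∣ l ^ k := dvd_pow (Nat.dvd_of_mem_divisors hd) hk0
        have hne : l ^ k / d ≠ 0 :=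
          (Nat.div_pos (Nat.le_of_dvd hlk hdl) (Nat.pos_of_mem_divisors hd)).ne'
        have hmud : |(ArithmeticFunction.moebius d : ℝ)| ≤ 1 := by
          exact_mod_cast ArithmeticFunction.abs_moebius_le_one
        have h2 : ((2 : ℝ) ^ l.primeFactors.card) ≤ l.divisors.card := by
          exact_mod_cast two_pow_card_primeFactors_le hl0
        have h3 : ((Q / l ^ k : ℕ) : ℝ) ≤ Q / l ^ 2 := by
          refine Nat.cast_div_le.trans ?_
          have : ((l : ℝ) ^ 2) ≤ ((l ^ k : ℕ) : ℝ) := by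
            exact_mod_cast Nat.pow_le_pow_right hl.1 hk
          gcongr
        rw [abs_mul]
        refine (mul_le_of_le_one_left (abs_nonneg _) hmud).trans ?_
        refine (hCb _ (hα.mul_natCast hne) _ hv l hl.1 _).trans ?_
        gcongr
      refine (Finset.abs_sum_le_sum_abs _ _).trans ((Finset.sum_le_card_nsmul _ _ _ hd).trans ?_)
      rw [nsmul_eq_mul]
      exact le_of_eq (by ring)
    · rw [Finset.sum_eq_zero, abs_zero]
      · positivity
      · intro r _
        rw [if_neg]
        intro h
        rw [Nat.cast_mul] at h
        exact hu (isUnit_of_mul_isUnit_left (h ▸ hbu))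
  rw [hlhs]
  refine (Finset.abs_sum_le_sum_abs _ _).trans ((Finset.sum_le_sum hl_bound).trans ?_)
  rw [← Finset.mul_sum]
  have := sum_card_divisors_sq_div_sq_le Q
  calc C * Q * ∑ l ∈ Finset.Ioc 0 Q, (l.divisors.card : ℝ) ^ 2 / l ^ 2 ≤ C * Q * 16 := by gcongr
    _ = C * 16 * Q := by ring

/-! ### Lower bound for the number of fractions -/

/-- The offset `x` is the same for every `z`, so it cancels when two counts are subtracted and only
an error of 1 remains. -/
theorem sum_Ioc_natCast_eq_bounds {M : ℕ} [NeZero M] (u : ZMod M) :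
    ∃ x : ℝ, ∀ z : ℕ, ((z : ℝ) / M + x - 1 ≤
        ∑ q ∈ Finset.Ioc 0 z, (if (q : ZMod M) = u then (1 : ℝ) else 0)) ∧
      ∑ q ∈ Finset.Ioc 0 z, (if (q : ZMod M) = u then (1 : ℝ) else 0) ≤ z / M + x ∧ x ≤ 1 := by
  obtain ⟨c, hc, hcm, rfl⟩ := exists_natCast_eq_mem_Icc u
  have hM : 0 < M := NeZero.pos M
  have hM0 : (0 : ℝ) < M := by exact_mod_cast hM
  refine ⟨(M - c) / M, fun z => ?_⟩
  rw [sum_Ioc_ite_natCast_eq hc hcm]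
  simp only [Finset.sum_const, Finset.card_range, nsmul_eq_mul, mul_one]
  have a3 : ((z + M - c : ℕ) : ℝ) = z + M - c := by
    rw [Nat.cast_sub (hcm.trans (Nat.le_add_left _ _))]; push_cast; ring
  have b1 : (((z + M - c) / M : ℕ) : ℝ) ≤ (z + M - c : ℕ) / M := Nat.cast_div_le
  have b2 : ((z + M - c : ℕ) : ℝ) / M < ((z + M - c) / M : ℕ) + 1 := by
    rw [div_lt_iff₀ hM0]
    exact_mod_cast Nat.lt_mul_of_div_lt (Nat.lt_succ_self ((z + M - c) / M)) hM
  rw [a3, add_sub_assoc, add_div] at b1 b2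
  refine ⟨by linarith, b1, ?_⟩
  rw [div_le_one hM0]
  have : (0 : ℝ) ≤ c := by positivity
  linarith

theorem sum_Ioc_natCast_eq_and_dvd_le {M : ℕ} [NeZero M] {u : ZMod M} (hu : IsUnit u) (Q : ℕ)
    {j : ℕ} (hj : 0 < j) :
    ∑ q ∈ Finset.Ioc 0 Q, (if j ∣ q then (if (q : ZMod M) = u then (1 : ℝ) else 0) else 0) ≤
      Q / (M * j) + 1 := by
  rw [← Finset.sum_filter, filter_dvd_Ioc_eq_image hj,
    Finset.sum_image fun a _ c _ h => Nat.eq_of_mul_eq_mul_left hj h]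
  by_cases hju : IsUnit (j : ZMod M)
  · obtain ⟨w, hw⟩ := hju
    simp only [natCast_mul_eq_iff w hw.symm]
    obtain ⟨x, hx⟩ := sum_Ioc_natCast_eq_bounds (((w⁻¹ : (ZMod M)ˣ) : ZMod M) * u)
    obtain ⟨-, h2, h3⟩ := hx (Q / j)
    refine h2.trans (add_le_add ?_ h3)
    rw [mul_comm, ← div_div]
    gcongr
    exact Nat.cast_div_le
  · rw [Finset.sum_eq_zero]
    · positivity
    · intro r _
      rw [if_neg]
      intro h
      rw [Nat.cast_mul] at h
      exact hju (isUnit_of_mul_isUnit_left (h ▸ hu))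

theorem le_sum_Ioc_natCast_eq_and_lt {M : ℕ} [NeZero M] (u : ZMod M) (Q : ℕ) :
    (Q : ℝ) / (2 * M) - 1 ≤
      ∑ q ∈ Finset.Ioc 0 Q, (if Q < 2 * q then (if (q : ZMod M) = u then (1 : ℝ) else 0) else 0) := by
  obtain ⟨x, hx⟩ := sum_Ioc_natCast_eq_bounds u
  obtain ⟨h1, -, -⟩ := hx Q
  obtain ⟨-, h2, -⟩ := hx (Q / 2)
  have hsplit := Finset.sum_Ioc_consecutive
    (fun q : ℕ => if (q : ZMod M) = u then (1 : ℝ) else 0) (Nat.zero_le (Q / 2)) (Nat.div_le_self Q 2)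
  have hfil : (Finset.Ioc 0 Q).filter (fun q => Q < 2 * q) = Finset.Ioc (Q / 2) Q := by
    ext q; simp only [Finset.mem_filter, Finset.mem_Ioc]; omega
  rw [← Finset.sum_filter, hfil]
  have hM0 : (0 : ℝ) < M := by exact_mod_cast NeZero.pos M
  have h3 : ((Q / 2 : ℕ) : ℝ) / M ≤ Q / (2 * M) := by
    rw [← div_div]; gcongr; exact Nat.cast_div_le
  have h4 : (Q : ℝ) / M = 2 * (Q / (2 * M)) := by field_simp
  linarith

theorem sum_Ioc_one_div_sq_tail_le {P : ℕ} (hP : 0 < P) (Q : ℕ) :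
    ∑ j ∈ Finset.Ioc P Q, (1 : ℝ) / j ^ 2 ≤ 1 / P := by
  have hP0 : (0 : ℝ) < P := by exact_mod_cast hP
  rcases le_or_gt Q P with h | h
  · rw [Finset.Ioc_eq_empty (by omega), Finset.sum_empty]; positivity
  have key : ∑ j ∈ Finset.Ioc P Q, (1 : ℝ) / j ^ 2 ≤ 1 / P - 1 / Q := by
    induction Q, h.le using Nat.le_induction with
    | base => simp
    | succ n hn ih =>
      rcases hn.eq_or_lt with rfl | hlt
      · rw [Finset.sum_Ioc_succ_top le_rfl, Finset.Ioc_self, Finset.sum_empty, zero_add]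
        push_cast
        rw [div_sub_div _ _ (by positivity) (by positivity),
          div_le_div_iff₀ (by positivity) (by positivity)]
        nlinarith
      · rw [Finset.sum_Ioc_succ_top hn]
        have hn0 : (0 : ℝ) < n := by exact_mod_cast (by omega : 0 < n)
        have : (1 : ℝ) / ((n + 1 : ℕ) : ℝ) ^ 2 ≤ 1 / n - 1 / (n + 1 : ℕ) := by
          push_cast
          rw [div_sub_div _ _ (by positivity) (by positivity),
            div_le_div_iff₀ (by positivity) (by positivity)]
          nlinarith
        linarith [ih hlt]
  have : (0 : ℝ) ≤ 1 / Q := by positivity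
  linarith

theorem sum_Ioc_one_div_le (P Q : ℕ) : ∑ j ∈ Finset.Ioc P Q, (1 : ℝ) / j ≤ 2 * √Q := by
  have h1 : ∑ j ∈ Finset.Ioc P Q, (1 : ℝ) / j ≤ ∑ j ∈ Finset.Ioc 0 Q, (1 : ℝ) / j :=
    Finset.sum_le_sum_of_subset_of_nonneg (Finset.Ioc_subset_Ioc_left (Nat.zero_le P))
      fun _ _ _ => by positivity
  refine h1.trans ?_
  have h2 := sq_sum_le_card_mul_sum_sq (s := Finset.Ioc 0 Q) (f := fun j : ℕ => (1 : ℝ) / j)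
  have h3 := sum_Ioc_one_div_sq_le Q
  simp only [div_pow, one_pow, Nat.card_Ioc, Nat.sub_zero] at h2
  refine abs_le_of_sq_le_sq' ?_ (by positivity) |>.2
  rw [mul_pow, Real.sq_sqrt (Nat.cast_nonneg Q)]
  nlinarith [Nat.cast_nonneg (α := ℝ) Q]

/-- Union bound: an `a` not coprime to `q` shares with it a prime exceeding `P`. Summing over all
divisors `j > P`, not only primes, is wasteful but easier to average over `q`. -/
theorem le_coprimeCount_self_add {q P Q : ℕ} (hqQ : q ≤ Q) (hq : 0 < q)
    (hP : ∀ p : ℕ, p.Prime → p ∣ q → P < p) :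
    (q : ℝ) ≤ coprimeCount q q + ∑ j ∈ Finset.Ioc P Q, if j ∣ q then (q : ℝ) / j else 0 := by
  have hsub : Finset.Ioc 0 q ⊆ (Finset.Ioc 0 q).filter (·.Coprime q) ∪
      ((Finset.Ioc P Q).filter (· ∣ q)).biUnion fun j => (Finset.Ioc 0 q).filter (j ∣ ·) := by
    intro a ha
    rw [Finset.mem_union, Finset.mem_filter]
    by_cases h : a.Coprime q
    · exact Or.inl ⟨ha, h⟩
    · obtain ⟨p, hp, hpa, hpq⟩ := Nat.Prime.not_coprime_iff_dvd.1 h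
      refine Or.inr (Finset.mem_biUnion.2 ⟨p, ?_, Finset.mem_filter.2 ⟨ha, hpa⟩⟩)
      exact Finset.mem_filter.2 ⟨Finset.mem_Ioc.2 ⟨hP p hp hpq, (Nat.le_of_dvd hq hpq).trans hqQ⟩, hpq⟩
  have h1 := (Finset.card_le_card hsub).trans ((Finset.card_union_le _ _).trans
    (Nat.add_le_add_left Finset.card_biUnion_le _))
  simp only [Nat.Ioc_filter_dvd_card_eq_div, Nat.card_Ioc, Nat.sub_zero] at h1
  have h2 : (q : ℝ) ≤ coprimeCount q q + ∑ j ∈ (Finset.Ioc P Q).filter (· ∣ q), ((q / j : ℕ) : ℝ) := by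
    exact_mod_cast h1
  refine h2.trans ?_
  rw [Finset.sum_filter]
  gcongr with j _
  split_ifs
  · exact Nat.cast_div_le
  · exact le_rfl

/-- Denominators in `(Q / 2, Q]` in a class mod `M` give `Q² / (4M)`. Non-coprime numerators and
square divisors each lose `Q² / (16M)` from the tail `∑_{j > 16} 1 / j²`, plus `O(Q √Q)`. Taking `√Q
≥ 64 M` bounds the lower-order terms by another `Q² / (16M)`, which leaves `Q² / (16M)`. -/
theorem exists_lower_bound_card_farey (m : ℕ) [NeZero m] :
    ∃ c : ℝ, 0 < c ∧ ∃ Q₀ : ℕ, ∀ k : ℕ, 2 ≤ k → ∀ b : ℤ, Int.gcd b m = 1 → ∀ Q : ℕ, Q₀ ≤ Q →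
      c * (Q : ℝ) ^ 2 ≤ (farey Q k m b).card := by
  classical
  set M := m * Nat.factorial 16 with hM
  have : NeZero M := ⟨Nat.mul_ne_zero (NeZero.ne m) (Nat.factorial_ne_zero 16)⟩
  have hM0 : (0 : ℝ) < M := by exact_mod_cast NeZero.pos M
  refine ⟨1 / (16 * M), by positivity, (64 * M) ^ 2, fun k hk b hb Q hQ => ?_⟩
  have hmM : m ∣ M := dvd_mul_right _ _
  -- Lifting `b` to a unit mod `M` keeps the congruence mod `m` and rules out every prime factor up
  -- to 16.
  obtain ⟨w, hw⟩ := ZMod.unitsMap_surjective hmM (isUnit_intCast_of_gcd_eq_one hb).unit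
  have hcast : ∀ q : ℕ, (q : ZMod M) = w → (q : ZMod m) = b := fun q hq => by
    have h1 := congrArg Units.val hw
    rw [ZMod.unitsMap_val, IsUnit.unit_spec, ← hq, ZMod.cast_natCast hmM] at h1
    exact h1
  have hprime : ∀ q : ℕ, (q : ZMod M) = w → ∀ p : ℕ, p.Prime → p ∣ q → 16 < p := fun q hq p hp hpq => by
    by_contra! hle
    have h1 : q.Coprime M := (ZMod.isUnit_iff_coprime q M).1 (hq ▸ w.isUnit)
    exact Nat.not_coprime_of_dvd_of_dvd hp.one_lt hpq
      (dvd_mul_of_dvd_right ((Nat.Prime.dvd_factorial hp).2 hle) m) h1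
  -- A minorant that is linear in divisibility indicators, hence easy to sum over `q`. If `q` is not
  -- `k`-free, some `p ^ 2` divides it, and the last sum, at least `Q`, makes the left side
  -- nonpositive.
  have hpoint : ∀ q ∈ Finset.Ioc 0 Q, (if (q : ZMod M) = w then (1 : ℝ) else 0) *
      ((if Q < 2 * q then (Q : ℝ) / 2 else 0) -
        (∑ j ∈ Finset.Ioc 16 Q, if j ∣ q then (Q : ℝ) / j else 0) -
        ∑ j ∈ Finset.Ioc 16 (Nat.sqrt Q), if j ^ 2 ∣ q then (Q : ℝ) else 0) ≤
      if KFree k q ∧ (q : ℤ) ≡ b [ZMOD (m : ℤ)] then (coprimeCount q q : ℝ) else 0 := by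
    intro q hq
    rw [Finset.mem_Ioc] at hq
    have s1 : 0 ≤ ∑ j ∈ Finset.Ioc 16 Q, if j ∣ q then (Q : ℝ) / j else 0 :=
      Finset.sum_nonneg fun j _ => by split_ifs <;> positivity
    have s2 : 0 ≤ ∑ j ∈ Finset.Ioc 16 (Nat.sqrt Q), if j ^ 2 ∣ q then (Q : ℝ) else 0 :=
      Finset.sum_nonneg fun j _ => by split_ifs <;> positivity
    by_cases hqw : (q : ZMod M) = w
    · rw [if_pos hqw, one_mul]
      by_cases hkf : KFree k q
      · have hadm : KFree k q ∧ (q : ℤ) ≡ b [ZMOD (m : ℤ)] :=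
          ⟨hkf, (natCast_modEq_iff q).2 (hcast q hqw)⟩
        rw [if_pos hadm]
        split_ifs with hlt
        · have h1 := le_coprimeCount_self_add hq.2 hq.1 (hprime q hqw)
          have h2 : (∑ j ∈ Finset.Ioc 16 Q, if j ∣ q then (q : ℝ) / j else 0) ≤
              ∑ j ∈ Finset.Ioc 16 Q, if j ∣ q then (Q : ℝ) / j else 0 := by
            have : (q : ℝ) ≤ Q := by exact_mod_cast hq.2
            refine Finset.sum_le_sum fun j _ => ?_
            split_ifs
            · gcongr
            · exact le_rfl
          have h3 : (Q : ℝ) < 2 * q := by exact_mod_cast hlt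
          linarith
        · have : (0 : ℝ) ≤ coprimeCount q q := Nat.cast_nonneg _
          linarith
      · have hadm : ¬(KFree k q ∧ (q : ℤ) ≡ b [ZMOD (m : ℤ)]) := fun h => hkf h.1
        rw [if_neg hadm]
        simp only [KFree, not_forall, not_not] at hkf
        obtain ⟨p, hp, hpq, hpk⟩ := hkf
        have hp2 : p ^ 2 ∣ q := (pow_dvd_pow p hk).trans hpk
        have hmem : p ∈ Finset.Ioc 16 (Nat.sqrt Q) := by
          rw [Finset.mem_Ioc, Nat.le_sqrt']
          exact ⟨hprime q hqw p hp hpq, (Nat.le_of_dvd hq.1 hp2).trans hq.2⟩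
        have h1 := Finset.single_le_sum (f := fun j => if j ^ 2 ∣ q then (Q : ℝ) else 0)
          (fun j _ => by split_ifs <;> positivity) hmem
        simp only [if_pos hp2] at h1
        have hQ0 : (0 : ℝ) ≤ Q := Nat.cast_nonneg _
        split_ifs <;> linarith
    · rw [if_neg hqw, zero_mul]
      split_ifs <;> positivity
  have hsum := Finset.sum_le_sum hpoint
  have hcard : ∑ q ∈ Finset.Ioc 0 Q, (if KFree k q ∧ (q : ℤ) ≡ b [ZMOD (m : ℤ)] then
      (coprimeCount q q : ℝ) else 0) = (farey Q k m b).card := by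
    rw [card_farey, Finset.sum_filter]
    push_cast
    rfl
  rw [hcard] at hsum
  have hexp : ∑ q ∈ Finset.Ioc 0 Q, (if (q : ZMod M) = w then (1 : ℝ) else 0) *
      ((if Q < 2 * q then (Q : ℝ) / 2 else 0) -
        (∑ j ∈ Finset.Ioc 16 Q, if j ∣ q then (Q : ℝ) / j else 0) -
        ∑ j ∈ Finset.Ioc 16 (Nat.sqrt Q), if j ^ 2 ∣ q then (Q : ℝ) else 0) =
      Q / 2 * ∑ q ∈ Finset.Ioc 0 Q,
        (if Q < 2 * q then (if (q : ZMod M) = w then (1 : ℝ) else 0) else 0) -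
      (∑ j ∈ Finset.Ioc 16 Q, Q / j * ∑ q ∈ Finset.Ioc 0 Q,
        (if j ∣ q then (if (q : ZMod M) = w then (1 : ℝ) else 0) else 0)) -
      ∑ j ∈ Finset.Ioc 16 (Nat.sqrt Q), Q * ∑ q ∈ Finset.Ioc 0 Q,
        (if j ^ 2 ∣ q then (if (q : ZMod M) = w then (1 : ℝ) else 0) else 0) := by
    simp only [Finset.mul_sum]
    rw [Finset.sum_comm (s := Finset.Ioc 16 Q), Finset.sum_comm (s := Finset.Ioc 16 (Nat.sqrt Q)),
      ← Finset.sum_sub_distrib, ← Finset.sum_sub_distrib]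
    refine Finset.sum_congr rfl fun q _ => ?_
    by_cases h : (q : ZMod M) = w <;> simp [h]
  rw [hexp] at hsum
  have t1 := le_sum_Ioc_natCast_eq_and_lt (w : ZMod M) Q
  have t2 : (∑ j ∈ Finset.Ioc 16 Q, Q / j * ∑ q ∈ Finset.Ioc 0 Q,
        (if j ∣ q then (if (q : ZMod M) = w then (1 : ℝ) else 0) else 0)) ≤
      Q ^ 2 / M * (1 / 16) + Q * (2 * √Q) := by
    calc _ ≤ ∑ j ∈ Finset.Ioc 16 Q, ((Q : ℝ) ^ 2 / M * (1 / j ^ 2) + Q * (1 / j)) := by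
          refine Finset.sum_le_sum fun j hj => ?_
          rw [Finset.mem_Ioc] at hj
          have hj0 : (0 : ℝ) < j := by exact_mod_cast (by omega : 0 < j)
          calc _ ≤ (Q : ℝ) / j * (Q / (M * j) + 1) := by
                gcongr
                exact sum_Ioc_natCast_eq_and_dvd_le w.isUnit Q (by omega)
            _ = _ := by field_simp
      _ ≤ _ := by
          rw [Finset.sum_add_distrib, ← Finset.mul_sum, ← Finset.mul_sum]
          have := sum_Ioc_one_div_sq_tail_le (P := 16) (by norm_num) Q
          have := sum_Ioc_one_div_le 16 Q
          push_cast at *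
          gcongr
  have t3 : (∑ j ∈ Finset.Ioc 16 (Nat.sqrt Q), Q * ∑ q ∈ Finset.Ioc 0 Q,
        (if j ^ 2 ∣ q then (if (q : ZMod M) = w then (1 : ℝ) else 0) else 0)) ≤
      Q ^ 2 / M * (1 / 16) + Q * √Q := by
    calc _ ≤ ∑ j ∈ Finset.Ioc 16 (Nat.sqrt Q), ((Q : ℝ) ^ 2 / M * (1 / j ^ 2) + Q) := by
          refine Finset.sum_le_sum fun j hj => ?_
          rw [Finset.mem_Ioc] at hj
          have hj0 : (0 : ℝ) < j := by exact_mod_cast (by omega : 0 < j)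
          have := sum_Ioc_natCast_eq_and_dvd_le w.isUnit Q (pow_pos (by omega : 0 < j) 2)
          calc _ ≤ (Q : ℝ) * (Q / (M * (j ^ 2 : ℕ)) + 1) := by gcongr
            _ = _ := by push_cast; field_simp
      _ ≤ _ := by
          rw [Finset.sum_add_distrib, ← Finset.mul_sum, Finset.sum_const, Nat.card_Ioc, nsmul_eq_mul]
          have h1 := sum_Ioc_one_div_sq_tail_le (P := 16) (by norm_num) (Nat.sqrt Q)
          have h2 : ((Nat.sqrt Q - 16 : ℕ) : ℝ) ≤ √Q := by
            have : ((Nat.sqrt Q - 16 : ℕ) : ℝ) ≤ Nat.sqrt Q := by exact_mod_cast Nat.sub_le _ _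
            exact this.trans (Real.nat_sqrt_le_real_sqrt)
          push_cast at h1
          rw [mul_comm (_ : ℝ) (Q : ℝ)]
          gcongr
  have hs : 64 * (M : ℝ) ≤ √Q := Real.le_sqrt_of_sq_le (by exact_mod_cast hQ)
  have hsq : √(Q : ℝ) ^ 2 = Q := Real.sq_sqrt (Nat.cast_nonneg Q)
  have hM1 : (1 : ℝ) ≤ M := by exact_mod_cast NeZero.pos M
  have hQ0 : (0 : ℝ) ≤ Q := Nat.cast_nonneg _
  have hQ1 : (Q : ℝ) ≤ Q * √Q := by nlinarith
  have hbig : (4 : ℝ) * (Q * √Q) ≤ Q ^ 2 / M / 16 := by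
    rw [div_div, le_div_iff₀ (by positivity)]
    calc (4 : ℝ) * (Q * √Q) * (M * 16) = Q * √Q * (64 * M) := by ring
      _ ≤ Q * √Q * √Q := by gcongr
      _ = Q ^ 2 := by rw [mul_assoc, ← sq, hsq]; ring
  have t1' : (Q : ℝ) / 2 * (Q / (2 * M) - 1) ≤ Q / 2 * ∑ q ∈ Finset.Ioc 0 Q,
        (if Q < 2 * q then (if (q : ZMod M) = w then (1 : ℝ) else 0) else 0) := by gcongr
  have e1 : (Q : ℝ) / 2 * (Q / (2 * M) - 1) = Q ^ 2 / M / 4 - Q / 2 := by field_simp; ring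
  have e2 : 1 / (16 * (M : ℝ)) * Q ^ 2 = Q ^ 2 / M / 16 := by field_simp
  rw [e2]
  linarith

/-! ### Passage from irrational to arbitrary endpoints, and conclusion -/

/-- The counting function is a right-continuous step function, hence constant just to the right of
`α`. This extends the irrational case to every `α < 1`. -/
theorem exists_irrational_countLE_eq (S : Finset ℝ) {α β : ℝ} (h : α < β) :
    ∃ γ, Irrational γ ∧ α < γ ∧ γ < β ∧ countLE S γ = countLE S α := by
  have h1 : ∀ᶠ γ in nhdsWithin α (Set.Ioi α), ∀ x ∈ S, α < x → γ < x := by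
    rw [Filter.eventually_all_finset]
    intro x _
    by_cases hx : α < x
    · filter_upwards [nhdsWithin_le_nhds (Iio_mem_nhds hx)] with γ hγ _ using hγ
    · exact Filter.Eventually.of_forall fun γ h => absurd h hx
  obtain ⟨u, hu, hsub⟩ := (mem_nhdsGT_iff_exists_Ioo_subset' h).1 h1
  obtain ⟨γ, hγ, h2, h3⟩ := exists_irrational_btwn (lt_min (Set.mem_Ioi.1 hu) h)
  refine ⟨γ, hγ, h2, h3.trans_le (min_le_right _ _), ?_⟩
  have h4 := hsub ⟨h2, h3.trans_le (min_le_left _ _)⟩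
  rw [countLE, countLE]
  congr 1
  refine Finset.filter_congr fun x hx => ⟨fun h5 => ?_, fun h5 => h5.trans h2.le⟩
  by_contra! h6
  exact absurd (h4 x hx h6) (not_lt.2 h5)

theorem abs_countLE_sub_le_of_irrational {S : Finset ℝ} {E : ℝ}
    (hE : ∀ γ, Irrational γ → 0 ≤ γ → γ ≤ 1 → |(countLE S γ : ℝ) - γ * S.card| ≤ E)
    {α : ℝ} (h0 : 0 ≤ α) (h1 : α < 1) : |(countLE S α : ℝ) - α * S.card| ≤ E := by
  refine le_of_forall_pos_le_add fun ε hε => ?_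
  have hN : (0 : ℝ) ≤ S.card := Nat.cast_nonneg _
  obtain ⟨γ, hγ, h2, h3, h4⟩ := exists_irrational_countLE_eq S
    (β := min 1 (α + ε / (S.card + 1))) (lt_min h1 (by linarith [show 0 < ε / (S.card + 1) by positivity]))
  have h5 := hE γ hγ (h0.trans h2.le) (h3.le.trans (min_le_left _ _))
  have h6 : γ - α ≤ ε / (S.card + 1) := by linarith [h3.le.trans (min_le_right _ _)]
  have h7 : (γ - α) * S.card ≤ ε := by
    rw [le_div_iff₀ (by positivity)] at h6
    nlinarith
  rw [h4] at h5
  have h8 : (countLE S α : ℝ) - α * S.card = (countLE S α - γ * S.card) + (γ - α) * S.card := by ring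
  rw [h8]
  refine (abs_add_le _ _).trans (add_le_add h5 ?_)
  rw [abs_of_nonneg (mul_nonneg (by linarith) hN)]
  exact h7

theorem deviation_le_one (S : Finset ℝ) {α : ℝ} (h0 : 0 ≤ α) (h1 : α ≤ 1) : deviation S α ≤ 1 := by
  have h2 : (countLE S α : ℝ) / (S.card : ℝ) ≤ 1 :=
    div_le_one_of_le₀ (by exact_mod_cast Finset.card_filter_le _ _) (by positivity)
  have h3 : (0 : ℝ) ≤ (countLE S α : ℝ) / (S.card : ℝ) := by positivity
  rw [deviation, abs_le]
  constructor <;> linarith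

theorem half_div_le_discrepancy_farey (k m : ℕ) (b : ℤ) {Q : ℕ} (hQ : 1 ≤ Q) :
    1 / 2 * (1 / (Q : ℝ)) ≤ discrepancy (farey Q k m b) := by
  have hQ1 : (1 : ℝ) ≤ Q := by exact_mod_cast hQ
  have hpos : (0 : ℝ) < 1 / Q := by positivity
  have hle : 1 / (Q : ℝ) ≤ 1 := (div_le_one (by linarith)).2 hQ1
  have hcount : countLE (farey Q k m b) (1 / 2 * (1 / (Q : ℝ))) = 0 := by
    rw [countLE, Finset.card_eq_zero, Finset.filter_eq_empty_iff]
    intro x hx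
    have := (one_div_le_and_le_one_of_mem_farey hx).1
    rw [not_le]; linarith
  have h := le_ciSup (bddAbove_deviation (farey Q k m b))
    ⟨1 / 2 * (1 / (Q : ℝ)), by positivity, by linarith⟩
  refine le_trans (le_of_eq ?_) h
  simp only [deviation, hcount, Nat.cast_zero, zero_div, zero_sub, abs_neg]
  rw [abs_of_pos (by positivity)]

end KFreeFarey

theorem theorem4 (m : ℕ) (hm : 1 ≤ m) :
    ∃ C₁ C₂ : ℝ, 0 < C₁ ∧ 0 < C₂ ∧
      ∀ (k : ℕ), 2 ≤ k → ∀ (b : ℤ), Int.gcd b (m : ℤ) = 1 →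
        ∀ (Q : ℕ), 1 ≤ Q → (KFreeFarey.farey Q k m b).Nonempty →
          C₁ * (1 / (Q : ℝ)) ≤ KFreeFarey.discrepancy (KFreeFarey.farey Q k m b) ∧
            KFreeFarey.discrepancy (KFreeFarey.farey Q k m b) ≤ C₂ * (1 / (Q : ℝ)) := by
  have : NeZero m := ⟨by omega⟩
  obtain ⟨C, hC, hupper⟩ := KFreeFarey.exists_bound_countLE_farey m
  obtain ⟨c, hc, Q₀, hlower⟩ := KFreeFarey.exists_lower_bound_card_farey m
  -- `Q₀` covers `Q < Q₀`, where the deviation is at most 1; `C / c` comes from dividing `C * Q` by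
  -- the cardinality bound `c * Q ^ 2`.
  refine ⟨1 / 2, Q₀ + C / c, by norm_num, by positivity, fun k hk b hb Q hQ hne =>
    ⟨KFreeFarey.half_div_le_discrepancy_farey k m b hQ, ?_⟩⟩
  have hQ0 : (0 : ℝ) < Q := by exact_mod_cast hQ
  have : Nonempty (Set.Icc (0 : ℝ) 1) := ⟨⟨0, by norm_num⟩⟩
  refine ciSup_le ?_
  rintro ⟨α, h0, h1⟩
  rw [mul_one_div, le_div_iff₀ hQ0]
  rcases lt_or_ge Q Q₀ with hsmall | hlarge
  · have h2 := KFreeFarey.deviation_le_one (KFreeFarey.farey Q k m b) h0 h1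
    have h3 : (Q : ℝ) ≤ Q₀ := by exact_mod_cast hsmall.le
    have h4 : 0 < C / c := by positivity
    nlinarith
  · have hN : (0 : ℝ) < (KFreeFarey.farey Q k m b).card := by exact_mod_cast hne.card_pos
    have hmain : |(KFreeFarey.countLE (KFreeFarey.farey Q k m b) α : ℝ) -
        α * (KFreeFarey.farey Q k m b).card| ≤ C * Q := by
      rcases h1.lt_or_eq with h1 | rfl
      · exact KFreeFarey.abs_countLE_sub_le_of_irrational
          (fun γ hγ g0 g1 => hupper k hk b hb Q γ hγ g0 g1) h0 h1
      -- At `α = 1` there is no room to the right inside the unit interval, but all points are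
      -- counted and the error vanishes.
      · rw [KFreeFarey.countLE_farey_one, one_mul, sub_self, abs_zero]
        positivity
    have hdev : KFreeFarey.deviation (KFreeFarey.farey Q k m b) α *
        (KFreeFarey.farey Q k m b).card ≤ C * Q := by
      refine le_trans (le_of_eq ?_) hmain
      rw [KFreeFarey.deviation]
      nth_rw 2 [← abs_of_pos hN]
      rw [← abs_mul, sub_mul, div_mul_cancel₀ _ hN.ne']
    have hlow := hlower k hk b hb Q hlarge
    have hd0 : 0 ≤ KFreeFarey.deviation (KFreeFarey.farey Q k m b) α := abs_nonneg _
    have h5 : KFreeFarey.deviation (KFreeFarey.farey Q k m b) α * Q * c ≤ C := by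
      have h6 := (mul_le_mul_of_nonneg_left hlow hd0).trans hdev
      have h7 : KFreeFarey.deviation (KFreeFarey.farey Q k m b) α * Q * c * Q ≤ C * Q := by
        linarith
      exact le_of_mul_le_mul_right h7 hQ0
    rw [← le_div_iff₀ hc] at h5
    have : (0 : ℝ) ≤ Q₀ := Nat.cast_nonneg _
    simp only
    linarith
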